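/- All graphs are finite and simple; $N(v)$ denotes the open neighbourhood of a vertex $v$. The weight of a function $f:V(G)\to\{0,1,2\}$ is $\sum_{v}f(v)$. **Parameters.** $\gamma(G)$ and $\gamma_t(G)$ are the domination and the total domination number of $G$. A *total dominating function* is an $f$ such that every vertex has a neighbour $u$ with $f(u)>0$. A *total Roman dominating function* (TRDF) is a total dominating function $f:V(G)\to\{0,1,2\}$ such that every $v$ with $f(v)=0$ has a neighbour $u$ with $f(u)=2$. A *total Roman $\{2\}$-dominating function* (TR2DF) is a total dominating function $f:V(G)\to\{0,1,2\}$ such that $\sum_{u\in N(v)}f(u)\ge 2$ for every $v$ with $f(v)=0$. The numbers $\gamma_{tR}(G)$ and $\gamma_{t\{R2\}}(G)$ are the minimum weights of a TRDF and of a TR2DF on $G$; a $\gamma_{tR}(G)$-function, respectively a $\gamma_{t\{R2\}}(G)$-function, is one attaining the minimum. A *near-TR2DF relative to $v$* is an $f:V(G)\to\{0,1,2\}$ such that every vertex with a positive label has a neighbour with a positive label, $\sum_{w\in N(u)}f(w)\ge 2$ for every $u\ne v$ with $f(u)=0$, and, if $f(v)=0$, $\sum_{w\in N(v)}f(w)\ge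 1$. The vertex $v$ is *near stable* if the minimum weight of a near-TR2DF relative to $v$ equals $\gamma_{t\{R2\}}(G)$. **Special vertices.** A leaf is a vertex of degree one, a support vertex is a vertex adjacent to a leaf, and a semi-support vertex is a vertex that is not a leaf and is adjacent to a support vertex; $L(G)$, $S(G)$, $SS(G)$ are the corresponding sets. $S_{adj}(G)$ is the set of support vertices adjacent to a support vertex. $S_{tR,2}(G)$ is the set of support vertices labelled $2$ by some $\gamma_{tR}(G)$-function, $L_{tR,1}(G)$ the set of leaves labelled $1$ by some $\gamma_{tR}(G)$-function, $W_0(G)$ the set of vertices labelled $0$ by all $\gamma_{t\{R2\}}(G)$-functions, and $S_1(G)$ the set of support vertices labelled $1$ by all $\gamma_{t\{R2\}}(G)$-functions. For $r\ge 1$, $R_r$ is the tree obtained from a single vertex $u$ (its centre) and $r$ disjoint copies of the path $P_4$ by joining $u$ by an edge to one support vertex of each copy. **The families.** $\mathcal F$ is the family of all trees $T$ for which there is a sequence of trees $T_0,\dots,T_k$ ($k\ge 0$) with $T_0\cong P_2$, $T_k\cong T$, such that each $T_i$ ($1\le i\le k$) is obtained from $T'=T_{i-1}$ by one of the following operations: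 - $F_1$: add a tree $R_r$ ($r\ge1$) and join its centre by an edge to an arbitrary vertex of $T'$; - $F_2$: add a new vertex and join it to a vertex of $S_{tR,2}(T')$; - $F_3$: add a new vertex and join it to a vertex of $S_1(T')$; - $F_4$: add a path $P_2$ and join one of its leaves to a vertex of $S_{adj}(T')$; - $F_5$: add a path $P_3$ and identify its support vertex with a vertex of $L_{tR,1}(T')$; - $F_6$: add a path $P_2$ and join one of its leaves to a near stable vertex in $L(T')\cup SS(T')$; - $F_7$: add a path $P_3$ and join one of its leaves to a vertex of $W_0(T')$. $\mathcal T$ is the family of all trees $T$ with $\gamma_t(T)=\gamma(T)$. **Theorem.** A tree $T$ of order $n\ge 2$ satisfies $\gamma_{t\{R2\}}(T)=2\gamma_t(T)$ if and only if $T\in\mathcal F\cap\mathcal T$. -/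

import Mathlib

namespace TotalRoman

noncomputable section

universe u

/-! ### Domination parameters -/

section Parameters

variable {V : Type u} [Fintype V] (G : SimpleGraph V)

/-- `f(N(v))`, the sum of the labels over the open neighbourhood of `v`. -/
def nbrWeight (f : V → ℕ) (v : V) : ℕ :=
  open Classical in ∑ u with G.Adj v u, f u

/-- The weight of a function. -/
def weight (f : V → ℕ) : ℕ := ∑ v, f v

/-- Dominating functions: every vertex labelled `0` has a neighbour with a positive label. -/
def IsDF (f : V → ℕ) : Prop :=
  ∀ v, f v = 0 → ∃ u, G.Adj v u ∧ 0 < f u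

/-- Total dominating functions: every vertex has a neighbour with a positive label. -/
def IsTDF (f : V → ℕ) : Prop :=
  ∀ v, ∃ u, G.Adj v u ∧ 0 < f u

/-- Roman `{2}`-dominating functions `V → {0, 1, 2}`. -/
def IsR2DF (f : V → ℕ) : Prop :=
  (∀ v, f v ≤ 2) ∧ IsDF G f ∧ ∀ v, f v = 0 → 2 ≤ nbrWeight G f v

/-- Total Roman `{2}`-dominating functions. -/
def IsTR2DF (f : V → ℕ) : Prop :=
  IsR2DF G f ∧ IsTDF G f

/-- Total Roman dominating functions `V → {0, 1, 2}`. -/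
def IsTRDF (f : V → ℕ) : Prop :=
  (∀ v, f v ≤ 2) ∧ IsTDF G f ∧ ∀ v, f v = 0 → ∃ u, G.Adj v u ∧ f u = 2

/-- Near total Roman `{2}`-dominating functions relative to `v`. The last condition says that the
subgraph induced by the vertices with positive labels has no isolated vertex. -/
def IsNearTR2DF (v : V) (f : V → ℕ) : Prop :=
  (∀ u, f u ≤ 2) ∧ (f v = 0 → 1 ≤ nbrWeight G f v) ∧
    (∀ u, u ≠ v → f u = 0 → 2 ≤ nbrWeight G f u) ∧
    ∀ u, 0 < f u → ∃ w, G.Adj u w ∧ 0 < f w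

/-- A dominating set. -/
def IsDominatingSet (S : Finset V) : Prop :=
  ∀ v, v ∉ S → ∃ u ∈ S, G.Adj v u

/-- A total dominating set. -/
def IsTotalDominatingSet (S : Finset V) : Prop :=
  ∀ v, ∃ u ∈ S, G.Adj v u

/-- The domination number `γ(G)`. -/
def gamma : ℕ := sInf {k | ∃ S : Finset V, IsDominatingSet G S ∧ S.card = k}

/-- The total domination number `γ_t(G)`. -/
def gammaT : ℕ := sInf {k | ∃ S : Finset V, IsTotalDominatingSet G S ∧ S.card = k}

/-- The total Roman domination number `γ_{tR}(G)`. -/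
def gammaTR : ℕ := sInf {k | ∃ f : V → ℕ, IsTRDF G f ∧ weight f = k}

/-- The total Roman `{2}`-domination number `γ_{t{R2}}(G)`. -/
def gammaTR2 : ℕ := sInf {k | ∃ f : V → ℕ, IsTR2DF G f ∧ weight f = k}

/-- The near total Roman `{2}`-domination number relative to `v`. -/
def gammaNearTR2 (v : V) : ℕ := sInf {k | ∃ f : V → ℕ, IsNearTR2DF G v f ∧ weight f = k}

/-- `γ_{tR}(G)`-functions. -/
def IsGammaTRFunction (f : V → ℕ) : Prop := IsTRDF G f ∧ weight f = gammaTR G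

/-- `γ_{t{R2}}(G)`-functions. -/
def IsGammaTR2Function (f : V → ℕ) : Prop := IsTR2DF G f ∧ weight f = gammaTR2 G

/-! ### Special vertices -/

/-- `L(G)`: vertices of degree one. -/
def leaves : Set V := {v | (G.neighborSet v).ncard = 1}

/-- `S(G)`: vertices adjacent to a leaf. -/
def supports : Set V := {v | ∃ h ∈ leaves G, G.Adj v h}

/-- `SS(G)`: vertices that are not leaves and are adjacent to a support vertex. -/
def semiSupports : Set V := {v | v ∉ leaves G ∧ ∃ s ∈ supports G, G.Adj v s}

/-- `S_adj(G)`: support vertices adjacent to another support vertex. -/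
def adjSupports : Set V := {v | v ∈ supports G ∧ ∃ s ∈ supports G, G.Adj v s}

/-- `S_{tR,2}(G)`: support vertices labelled with two by some `γ_{tR}(G)`-function. -/
def supportsTRTwo : Set V := {v | v ∈ supports G ∧ ∃ f, IsGammaTRFunction G f ∧ f v = 2}

/-- `L_{tR,1}(G)`: leaves labelled with one by some `γ_{tR}(G)`-function. -/
def leavesTROne : Set V := {v | v ∈ leaves G ∧ ∃ f, IsGammaTRFunction G f ∧ f v = 1}

/-- `W_0(G)`: vertices labelled with zero by all `γ_{t{R2}}(G)`-functions. -/
def alwaysZero : Set V := {v | ∀ f, IsGammaTR2Function G f → f v = 0}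

/-- `S_1(G)`: support vertices labelled with one by all `γ_{t{R2}}(G)`-functions. -/
def supportsAlwaysOne : Set V := {v | v ∈ supports G ∧ ∀ f, IsGammaTR2Function G f → f v = 1}

/-- Near stable vertices. -/
def IsNearStable (v : V) : Prop := gammaNearTR2 G v = gammaTR2 G

end Parameters

/-! ### Graph constructions -/

/-- The disjoint union of `G` and `H` together with the edge joining `v` and `w`. -/
def joinAt {V : Type u} {W : Type*} (G : SimpleGraph V) (H : SimpleGraph W) (v : V) (w : W) :
    SimpleGraph (V ⊕ W) :=
  G.sum H ⊔ SimpleGraph.edge (Sum.inl v) (Sum.inr w)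

/-- The graph obtained from disjoint copies of `G` and `H` by identifying the vertex `w` of `H`
with the vertex `v` of `G`. -/
def identifyAt {V : Type u} {W : Type*} (G : SimpleGraph V) (H : SimpleGraph W) (v : V) (w : W) :
    SimpleGraph (V ⊕ {x : W // x ≠ w}) :=
  SimpleGraph.fromRel fun a b =>
    match a, b with
    | Sum.inl a, Sum.inl b => G.Adj a b
    | Sum.inr x, Sum.inr y => H.Adj x.1 y.1
    | Sum.inl a, Sum.inr x => a = v ∧ H.Adj w x.1
    | Sum.inr _, Sum.inl _ => False

/-- The tree `R_r`: one vertex `none` and `r` copies of the path `P_4` with vertices `0, 1, 2, 3`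
in this order, the support vertex `1` of every copy being joined to `none`. -/
def treeR (r : ℕ) : SimpleGraph (Option (Fin r × Fin 4)) :=
  SimpleGraph.fromRel fun a b =>
    match a, b with
    | none, some (_, j) => j = 1
    | some (i, j), some (i', j') => i = i' ∧ (SimpleGraph.pathGraph 4).Adj j j'
    | _, none => False

/-! ### The seven operations

In each of them `H` is the graph obtained, up to isomorphism, from `G`. -/

section Operations

variable {V W : Type u} [Fintype V] (G : SimpleGraph V) (H : SimpleGraph W)

/-- Add a tree `R_r` and join its centre to an arbitrary vertex. -/
def OpF1 : Prop :=
  ∃ r : ℕ, 1 ≤ r ∧ ∃ v : V, Nonempty (H ≃g joinAt G (treeR r) v none)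

/-- Add a new vertex and join it to a vertex of `S_{tR,2}`. -/
def OpF2 : Prop :=
  ∃ v ∈ supportsTRTwo G, Nonempty (H ≃g joinAt G (SimpleGraph.pathGraph 1) v 0)

/-- Add a new vertex and join it to a vertex of `S_1`. -/
def OpF3 : Prop :=
  ∃ v ∈ supportsAlwaysOne G, Nonempty (H ≃g joinAt G (SimpleGraph.pathGraph 1) v 0)

/-- Add a path `P_2` and join a leaf of it to a vertex of `S_adj`. -/
def OpF4 : Prop :=
  ∃ v ∈ adjSupports G, Nonempty (H ≃g joinAt G (SimpleGraph.pathGraph 2) v 0)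

/-- Add a path `P_3` and identify its support vertex with a vertex of `L_{tR,1}`. -/
def OpF5 : Prop :=
  ∃ v ∈ leavesTROne G, Nonempty (H ≃g identifyAt G (SimpleGraph.pathGraph 3) v 1)

/-- Add a path `P_2` and join a leaf of it to a near stable vertex that is a leaf or a
semi-support vertex. -/
def OpF6 : Prop :=
  ∃ v ∈ leaves G ∪ semiSupports G, IsNearStable G v ∧
    Nonempty (H ≃g joinAt G (SimpleGraph.pathGraph 2) v 0)

/-- Add a path `P_3` and join a leaf of it to a vertex of `W_0`. -/
def OpF7 : Prop :=
  ∃ v ∈ alwaysZero G, Nonempty (H ≃g joinAt G (SimpleGraph.pathGraph 3) v 0)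

/-- `H` is obtained from `G` by one of the seven operations. -/
def IsStep : Prop :=
  OpF1 G H ∨ OpF2 G H ∨ OpF3 G H ∨ OpF4 G H ∨ OpF5 G H ∨ OpF6 G H ∨ OpF7 G H

end Operations

/-- The family `𝓕`: graphs obtained from `P_2` by a finite sequence of operations. -/
inductive FamilyF : ∀ {V : Type u} [Fintype V], SimpleGraph V → Prop
  | base {V : Type u} [Fintype V] (G : SimpleGraph V)
      (h : Nonempty (G ≃g SimpleGraph.pathGraph 2)) : FamilyF G
  | step {V W : Type u} [Fintype V] [Fintype W] (G : SimpleGraph V) (H : SimpleGraph W)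
      (hG : FamilyF G) (h : IsStep G H) : FamilyF H

/-- The family `𝓣`: trees whose domination and total domination numbers coincide. -/
def FamilyT {V : Type u} [Fintype V] (G : SimpleGraph V) : Prop :=
  G.IsTree ∧ gammaT G = gamma G

end

end TotalRoman

namespace TotalRoman

open SimpleGraph

universe u

/-! ### Rooted trees: depth and parents -/

section Trees

variable {V : Type*} {T : SimpleGraph V}

/-! On a tree with at least two vertices, 2γ ≤ γ_{t{R2}} ≤ γ + γ_t ≤ 2γ_t, so the equality in
question says exactly that γ_t = γ. The middle bound adds the indicators of a minimum dominating and
a minimum total dominating set (`gammaTR2_le_gamma_add_gammaT`). For the first, every closed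
neighbourhood has weight at least 2 under a TR2DF, and a tree has a dominating set no larger than
some family of disjoint closed neighbourhoods (`exists_dominating_packing`). The converse
implication thus needs only membership in 𝓣, and what remains is that γ_t = γ puts the tree in 𝓕.

This is an induction on the order within the class `IsTight`, which contains the trees with γ_t = γ;
on a tree, tightness amounts to γ_{tR} = γ_{t{R2}} = 2γ. Three removals preserve tightness and show
that the attachment vertex meets the requirements of an operation: one of two leaves with a common
support (F_2, `isTight_of_join_leaf`), a pendant P_2 (F_6, `isTight_of_join_edge`) and a pendant R_r
(F_1, `isTight_of_join_treeR`). Looking at a vertex farthest from a root shows that one of them is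
always available unless the tree is P_2 (`familyF_of_subtrees`), so the other four operations are
never needed. -/

theorem exists_parent (hT : T.IsTree) (r : V) {x : V} (hx : x ≠ r) :
    ∃ y, T.Adj x y ∧ T.dist r x = T.dist r y + 1 := by
  obtain ⟨p, hp⟩ := hT.1.exists_walk_length_eq_dist x r
  cases p with
  | nil => exact absurd rfl hx
  | @cons _ y _ h q =>
    refine ⟨y, h, ?_⟩
    have h1 := dist_le q
    rw [Walk.length_cons] at hp
    rw [dist_comm (u := r), dist_comm (u := r)]
    have := hT.dist_eq_dist_add_one_of_adj r h
    rw [dist_comm (u := r), dist_comm (u := r)] at this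
    omega

theorem parent_unique (hT : T.IsTree) (r : V) {x y z : V} (hy : T.Adj x y) (hz : T.Adj x z)
    (dy : T.dist r x = T.dist r y + 1) (dz : T.dist r x = T.dist r z + 1) : y = z := by
  obtain ⟨p, hp, hpl⟩ := hT.1.exists_path_of_dist y r
  obtain ⟨q, hq, hql⟩ := hT.1.exists_path_of_dist z r
  have key : ∀ {w : V} (s : T.Walk w r), s.IsPath → s.length = T.dist w r →
      T.dist r x = T.dist r w + 1 → (h : T.Adj x w) → (Walk.cons h s).IsPath := by
    intro w s hs hl hd h
    apply Walk.isPath_of_length_eq_dist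
    rw [Walk.length_cons, hl, dist_comm (u := x), dist_comm (u := w), hd]
  have h := (hT.existsUnique_path x r).unique (key p hp hpl dy hy) (key q hq hql dz hz)
  injection h

theorem dist_adj (hT : T.IsTree) (r : V) {x y : V} (h : T.Adj x y) :
    T.dist r x = T.dist r y + 1 ∨ T.dist r y = T.dist r x + 1 :=
  hT.dist_eq_dist_add_one_of_adj r h

end Trees

/-! ### Packings and the chain 2γ ≤ γ_{t{R2}} ≤ γ + γ_t -/

section Packing

variable {V : Type*} [Fintype V] {T : SimpleGraph V}

/-- The sum of the labels over the closed neighbourhood of `v`. -/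
noncomputable def closedWeight (T : SimpleGraph V) (f : V → ℕ) (v : V) : ℕ :=
  open Classical in ∑ z with (z = v ∨ T.Adj v z), f z

theorem le_nbrWeight {f : V → ℕ} {v u : V} (h : T.Adj v u) : f u ≤ nbrWeight T f v := by
  classical
  unfold nbrWeight
  exact Finset.single_le_sum (f := f) (fun _ _ => Nat.zero_le _) (by simp [h])

theorem add_le_nbrWeight {f : V → ℕ} {v u w : V} (h : T.Adj v u) (h' : T.Adj v w) (hne : u ≠ w) :
    f u + f w ≤ nbrWeight T f v := by
  classical
  unfold nbrWeight
  rw [← Finset.sum_pair hne]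
  apply Finset.sum_le_sum_of_subset
  intro z
  simp only [Finset.mem_insert, Finset.mem_singleton, Finset.mem_filter, Finset.mem_univ, true_and]
  rintro (rfl | rfl) <;> assumption

theorem exists_pos_of_nbrWeight_pos {f : V → ℕ} {v : V} (h : 0 < nbrWeight T f v) :
    ∃ u, T.Adj v u ∧ 0 < f u := by
  classical
  by_contra! hc
  have : nbrWeight T f v = 0 := by
    unfold nbrWeight
    apply Finset.sum_eq_zero
    intro u hu
    have := hc u (by simpa using hu)
    omega
  omega

theorem nbrWeight_le_closedWeight {f : V → ℕ} {v : V} : nbrWeight T f v ≤ closedWeight T f v := by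
  classical
  unfold nbrWeight closedWeight
  apply Finset.sum_le_sum_of_subset
  intro z
  simp only [Finset.mem_filter, Finset.mem_univ, true_and]
  exact Or.inr

theorem add_le_closedWeight {f : V → ℕ} {v u : V} (h : T.Adj v u) :
    f v + f u ≤ closedWeight T f v := by
  classical
  unfold closedWeight
  rw [← Finset.sum_pair h.ne]
  apply Finset.sum_le_sum_of_subset
  intro z
  simp only [Finset.mem_insert, Finset.mem_singleton, Finset.mem_filter, Finset.mem_univ, true_and]
  rintro (rfl | rfl)
  · exact Or.inl rfl
  · exact Or.inr h

omit [Fintype V] in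
/-- In a tree, every set of vertices can be dominated by as many vertices as some packing
contained in it has. -/
theorem exists_dominating_packing (hT : T.IsTree) (U : Finset V) :
    ∃ D P : Finset V, (∀ u ∈ U, u ∉ D → ∃ d ∈ D, T.Adj u d) ∧ P ⊆ U ∧ D.card ≤ P.card ∧
      ∀ p ∈ P, ∀ q ∈ P, p ≠ q → ∀ z, (z = p ∨ T.Adj p z) → ¬ (z = q ∨ T.Adj q z) := by
  classical
  obtain ⟨r⟩ := hT.1.nonempty
  induction U using Finset.strongInduction with
  | H U ih =>
  rcases U.eq_empty_or_nonempty with rfl | hne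
  · exact ⟨∅, ∅, by simp, by simp, le_rfl, by simp⟩
  -- Greedy choice: `v` is a deepest vertex of `U`. Its parent `c` (or `v` itself at the root) goes
  -- into `D`, `v` goes into `P`, and the closed neighbourhood of `c` leaves `U`.
  obtain ⟨v, hv, hmax⟩ := U.exists_max_image (T.dist r) hne
  obtain ⟨c, hc, hcv⟩ : ∃ c, (c = v ∨ T.Adj v c) ∧
      ∀ y, T.Adj v y → y = c ∨ T.dist r y = T.dist r v + 1 := by
    by_cases hr : v = r
    · refine ⟨v, Or.inl rfl, fun y hy => ?_⟩
      have := dist_adj hT r hy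
      subst hr
      simp only [dist_self] at this ⊢
      omega
    · obtain ⟨c, hc, hd⟩ := exists_parent hT r hr
      refine ⟨c, Or.inr hc, fun y hy => ?_⟩
      rcases dist_adj hT r hy with h | h
      · exact Or.inl (parent_unique hT r hy hc h hd)
      · exact Or.inr h
  obtain ⟨D, P, hD, hPU, hcard, hP⟩ := ih (U.filter fun u => ¬ (u = c ∨ T.Adj c u)) (by
    apply Finset.filter_ssubset.2
    refine ⟨v, hv, ?_⟩
    rw [not_not]
    exact hc.imp Eq.symm fun h => h.symm)
  have hPU' : ∀ p ∈ P, p ∈ U ∧ p ≠ c ∧ ¬ T.Adj c p := by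
    intro p hp
    simpa using hPU hp
  -- No remaining `q` is deeper than `v`, so `q` is not a child of `v`. A common neighbour would be
  -- `c`, which `q` avoids, or a child of `v`, which would then have both `v` and `q` as parents.
  have hfar : ∀ q ∈ P, ∀ z, (z = v ∨ T.Adj v z) → ¬ (z = q ∨ T.Adj q z) := by
    intro q hq z hz hz'
    obtain ⟨hqU, hqc, hcq⟩ := hPU' q hq
    have hdq := hmax q hqU
    have hvq : ¬ T.Adj v q := by
      intro h
      rcases hcv q h with h | h
      · exact hqc h
      · omega
    have hne : q ≠ v := by
      rintro rfl
      rcases hc with h | h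
      · exact hqc h.symm
      · exact hcq h.symm
    rcases hz with rfl | hz
    · rcases hz' with h | h
      · exact hne h.symm
      · exact hvq h.symm
    · rcases hz' with rfl | hz'
      · exact hvq hz
      · rcases hcv z hz with rfl | h
        · exact hcq hz'.symm
        · apply hne
          refine parent_unique hT r hz'.symm hz.symm ?_ h
          rcases dist_adj hT r hz' with h' | h' <;> omega
  have hvP : v ∉ P := fun h => hfar v h v (Or.inl rfl) (Or.inl rfl)
  refine ⟨insert c D, insert v P, ?_, ?_, ?_, ?_⟩
  · intro u hu huD
    rw [Finset.mem_insert, not_or] at huD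
    by_cases h : T.Adj c u
    · exact ⟨c, Finset.mem_insert_self _ _, h.symm⟩
    · obtain ⟨d, hd, hud⟩ := hD u (by simp [hu, huD.1, h]) huD.2
      exact ⟨d, Finset.mem_insert_of_mem hd, hud⟩
  · intro p hp
    rcases Finset.mem_insert.1 hp with rfl | hp
    · exact hv
    · exact (hPU' p hp).1
  · rw [Finset.card_insert_of_notMem hvP]
    exact (Finset.card_insert_le _ _).trans (by omega)
  · intro p hp q hq hpq z hz hz'
    rcases Finset.mem_insert.1 hp with rfl | hp' <;> rcases Finset.mem_insert.1 hq with rfl | hq'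
    · exact hpq rfl
    · exact hfar q hq' z hz hz'
    · exact hfar p hp' z hz' hz
    · exact hP p hp' q hq' hpq z hz hz'

/-- The packing vertices have disjoint closed neighbourhoods, so each claims two units of weight of
its own. The restriction to `U` allows labelings that violate the weight condition at a few
vertices. -/
theorem exists_dominating_of_closedWeight (hT : T.IsTree) (U : Finset V) (f : V → ℕ)
    (hf : ∀ u ∈ U, 2 ≤ closedWeight T f u) :
    ∃ D : Finset V, (∀ u ∈ U, u ∉ D → ∃ d ∈ D, T.Adj u d) ∧ 2 * D.card ≤ weight f := by
  classical
  obtain ⟨D, P, hD, hPU, hcard, hP⟩ := exists_dominating_packing hT U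
  refine ⟨D, hD, ?_⟩
  have h1 : 2 * P.card ≤ ∑ p ∈ P, closedWeight T f p := by
    rw [mul_comm, ← smul_eq_mul]
    exact Finset.card_nsmul_le_sum _ _ _ fun p hp => hf p (hPU hp)
  have h2 : ∑ p ∈ P, closedWeight T f p ≤ weight f := by
    unfold closedWeight weight
    rw [← Finset.sum_biUnion]
    · exact Finset.sum_le_sum_of_subset (Finset.subset_univ _)
    · intro p hp q hq hpq
      rw [Function.onFun, Finset.disjoint_left]
      intro z hz hz'
      exact hP p hp q hq hpq z (by simpa using hz) (by simpa using hz')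
  omega

theorem two_le_closedWeight_of_pos {f : V → ℕ} {v u : V} (h : T.Adj v u) (hv : 0 < f v)
    (hu : 0 < f u) : 2 ≤ closedWeight T f v :=
  le_trans (by omega) (add_le_closedWeight h)

theorem IsTR2DF.two_le_closedWeight {f : V → ℕ} (hf : IsTR2DF T f) (v : V) :
    2 ≤ closedWeight T f v := by
  rcases Nat.eq_zero_or_pos (f v) with h | h
  · exact (hf.1.2.2 v h).trans nbrWeight_le_closedWeight
  · obtain ⟨u, hu, hfu⟩ := hf.2 v
    exact two_le_closedWeight_of_pos hu h hfu

theorem IsTR2DF.exists_dominating (hT : T.IsTree) {f : V → ℕ} (hf : IsTR2DF T f) :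
    ∃ D : Finset V, IsDominatingSet T D ∧ 2 * D.card ≤ weight f := by
  obtain ⟨D, hD, h⟩ := exists_dominating_of_closedWeight hT Finset.univ f
    fun u _ => hf.two_le_closedWeight u
  exact ⟨D, fun v => hD v (Finset.mem_univ v), h⟩

theorem IsTRDF.isTR2DF {f : V → ℕ} (hf : IsTRDF T f) : IsTR2DF T f := by
  refine ⟨⟨hf.1, fun v _ => hf.2.1 v, fun v hv => ?_⟩, hf.2.1⟩
  obtain ⟨u, hu, hu2⟩ := hf.2.2 v hv
  exact hu2 ▸ le_nbrWeight hu

theorem gammaTR_le {f : V → ℕ} (hf : IsTRDF T f) : gammaTR T ≤ weight f :=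
  Nat.sInf_le ⟨f, hf, rfl⟩

theorem gammaTR2_le {f : V → ℕ} (hf : IsTR2DF T f) : gammaTR2 T ≤ weight f :=
  Nat.sInf_le ⟨f, hf, rfl⟩

omit [Fintype V] in
theorem gamma_le {S : Finset V} (hS : IsDominatingSet T S) : gamma T ≤ S.card :=
  Nat.sInf_le ⟨S, hS, rfl⟩

theorem exists_gamma (T : SimpleGraph V) :
    ∃ S : Finset V, IsDominatingSet T S ∧ S.card = gamma T :=
  Nat.sInf_mem (s := {k | ∃ S : Finset V, IsDominatingSet T S ∧ S.card = k})
    ⟨_, Finset.univ, fun v hv => absurd (Finset.mem_univ v) hv, rfl⟩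

theorem exists_gammaT (h : ∀ v, ∃ u, T.Adj v u) :
    ∃ S : Finset V, IsTotalDominatingSet T S ∧ S.card = gammaT T :=
  Nat.sInf_mem (s := {k | ∃ S : Finset V, IsTotalDominatingSet T S ∧ S.card = k})
    ⟨_, Finset.univ, fun v => (h v).imp fun u hu => ⟨Finset.mem_univ u, hu⟩, rfl⟩

theorem exists_isGammaTR2Function (h : ∃ f, IsTR2DF T f) : ∃ f, IsGammaTR2Function T f := by
  obtain ⟨f, hf⟩ := h
  exact Nat.sInf_mem (s := {k | ∃ f : V → ℕ, IsTR2DF T f ∧ weight f = k}) ⟨_, f, hf, rfl⟩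

omit [Fintype V] in
theorem IsTotalDominatingSet.isTRDF [DecidableEq V] {S : Finset V}
    (hS : IsTotalDominatingSet T S) : IsTRDF T fun v => if v ∈ S then 2 else 0 := by
  refine ⟨fun v => by dsimp only; split_ifs <;> omega, fun v => ?_, fun v _ => ?_⟩ <;>
  · obtain ⟨u, hu, h⟩ := hS v
    exact ⟨u, h, by simp [hu]⟩

theorem weight_indicator [DecidableEq V] (S : Finset V) (k : ℕ) :
    weight (fun v => if v ∈ S then k else 0) = k * S.card := by
  simp [weight, mul_comm]

theorem gamma_le_gammaT (h : ∀ v, ∃ u, T.Adj v u) : gamma T ≤ gammaT T := by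
  obtain ⟨S, hS, hc⟩ := exists_gammaT h
  exact hc ▸ gamma_le fun v _ => hS v

/-- The sum of the two indicators works: a vertex labelled 0 has a neighbour in each set, and if the
two neighbours coincide, that vertex has label 2. -/
theorem gammaTR2_le_gamma_add_gammaT (h : ∀ v, ∃ u, T.Adj v u) :
    gammaTR2 T ≤ gamma T + gammaT T := by
  classical
  obtain ⟨D, hD, hDc⟩ := exists_gamma T
  obtain ⟨S, hS, hSc⟩ := exists_gammaT h
  have hf : IsTR2DF T fun v => (if v ∈ D then 1 else 0) + if v ∈ S then 1 else 0 := by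
    have htd : IsTDF T fun v => (if v ∈ D then 1 else 0) + if v ∈ S then 1 else 0 := by
      intro v
      obtain ⟨u, hu, hvu⟩ := hS v
      exact ⟨u, hvu, by simp [hu]⟩
    refine ⟨⟨fun v => by dsimp only; split_ifs <;> omega, fun v _ => htd v, fun v hv => ?_⟩, htd⟩
    obtain ⟨u, hu, hvu⟩ := hS v
    obtain ⟨w, hw, hvw⟩ := hD v fun hvD => by simp [hvD] at hv
    by_cases huw : u = w
    · subst huw
      refine le_trans ?_ (le_nbrWeight hvu)
      simp [hu, hw]
    · refine le_trans ?_ (add_le_nbrWeight hvu hvw huw)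
      simp only [hu, hw, if_true]
      omega
  refine (gammaTR2_le hf).trans ?_
  have := weight_indicator D 1
  have := weight_indicator S 1
  simp only [weight, Finset.sum_add_distrib] at *
  omega

theorem two_mul_gamma_le_gammaTR2 (hT : T.IsTree) (h : ∀ v, ∃ u, T.Adj v u) :
    2 * gamma T ≤ gammaTR2 T := by
  classical
  obtain ⟨S, hS, -⟩ := exists_gammaT h
  obtain ⟨f, hf, hw⟩ := exists_isGammaTR2Function ⟨_, hS.isTRDF.isTR2DF⟩
  obtain ⟨D, hD, hDf⟩ := hf.exists_dominating hT
  have := gamma_le hD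
  omega

end Packing

/-! ### Adjacency in a join -/

section Join

variable {V W : Type*} {G : SimpleGraph V} {H : SimpleGraph W} {v : V} {w : W}

@[simp] theorem joinAt_inl_inl {a b : V} :
    (joinAt G H v w).Adj (Sum.inl a) (Sum.inl b) ↔ G.Adj a b := by
  simp [joinAt, edge_adj]

@[simp] theorem joinAt_inr_inr {a b : W} :
    (joinAt G H v w).Adj (Sum.inr a) (Sum.inr b) ↔ H.Adj a b := by
  simp [joinAt, edge_adj]

@[simp] theorem joinAt_inl_inr {a : V} {b : W} :
    (joinAt G H v w).Adj (Sum.inl a) (Sum.inr b) ↔ a = v ∧ b = w := by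
  simp [joinAt, edge_adj]

@[simp] theorem joinAt_inr_inl {a : V} {b : W} :
    (joinAt G H v w).Adj (Sum.inr b) (Sum.inl a) ↔ a = v ∧ b = w := by
  simp [joinAt, edge_adj, and_comm]

end Join

/-! ### Repairing a labeling that fails at one vertex -/

section Labels

variable {V : Type*} {G : SimpleGraph V}

/-- The conditions on a total Roman dominating function at the single vertex `x`. -/
def IsTRDFAt (G : SimpleGraph V) (f : V → ℕ) (x : V) : Prop :=
  (∃ u, G.Adj x u ∧ 0 < f u) ∧ (f x = 0 → ∃ u, G.Adj x u ∧ f u = 2)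

theorem isTRDF_iff {f : V → ℕ} : IsTRDF G f ↔ (∀ x, f x ≤ 2) ∧ ∀ x, IsTRDFAt G f x :=
  ⟨fun h => ⟨h.1, fun x => ⟨h.2.1 x, h.2.2 x⟩⟩, fun h => ⟨h.1, fun x => (h.2 x).1, fun x => (h.2 x).2⟩⟩

theorem IsTRDFAt.mono {f g : V → ℕ} {x : V} (hf : IsTRDFAt G f x) (hfg : ∀ y, f y ≤ g y)
    (hg : ∀ y, g y ≤ 2) : IsTRDFAt G g x := by
  obtain ⟨⟨u, hu, hfu⟩, h2⟩ := hf
  refine ⟨⟨u, hu, hfu.trans_le (hfg u)⟩, fun hx => ?_⟩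
  obtain ⟨z, hz, hfz⟩ := h2 (Nat.le_zero.1 (hx ▸ hfg x))
  exact ⟨z, hz, le_antisymm (hg z) (hfz ▸ hfg z)⟩

theorem weight_update [Fintype V] [DecidableEq V] (f : V → ℕ) (a : V) (k : ℕ) :
    weight (Function.update f a k) + f a = weight f + k := by
  unfold weight
  rw [Finset.sum_update_of_mem (Finset.mem_univ a), ← Finset.add_sum_erase _ f (Finset.mem_univ a),
    ← Finset.erase_eq]
  omega

theorem weight_sum {W : Type*} [Fintype V] [Fintype W] (f : V ⊕ W → ℕ) :
    weight f = weight (fun x => f (Sum.inl x)) + weight fun y => f (Sum.inr y) :=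
  Fintype.sum_sum_type f

/-- Raising `v` to at least 1 removes the demand for a neighbour labelled 2, and raising labels
harms no other vertex. -/
theorem exists_isTRDF_of_pos_neighbour [Fintype V] {f : V → ℕ} {v s : V} (hf : ∀ x, f x ≤ 2)
    (hoff : ∀ x, x ≠ v → IsTRDFAt G f x) (hs : G.Adj v s) (hfs : 0 < f s) :
    ∃ g, IsTRDF G g ∧ weight g ≤ weight f + 1 := by
  classical
  have hle : ∀ y, f y ≤ Function.update f v (max (f v) 1) y := by
    intro y
    by_cases h : y = v
    · subst h; simp
    · simp [h]
  have h2 : ∀ y, Function.update f v (max (f v) 1) y ≤ 2 := by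
    intro y
    by_cases h : y = v
    · subst h; simpa using hf y
    · simpa [h] using hf y
  refine ⟨Function.update f v (max (f v) 1), isTRDF_iff.2 ⟨h2, fun x => ?_⟩, ?_⟩
  · by_cases h : x = v
    · subst h
      refine ⟨⟨s, hs, hfs.trans_le (hle s)⟩, fun h0 => ?_⟩
      rw [Function.update_self] at h0
      omega
    · exact (hoff x h).mono hle h2
  · have := weight_update f v (max (f v) 1)
    omega

theorem exists_isTRDF_of_neighbour [Fintype V] {f : V → ℕ} {v z : V} (hf : ∀ x, f x ≤ 2)
    (hoff : ∀ x, x ≠ v → IsTRDFAt G f x) (hz : G.Adj v z) :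
    ∃ g, IsTRDF G g ∧ weight g ≤ weight f + 2 ∧ (0 < f v → weight g ≤ weight f + 1) := by
  classical
  have hle : ∀ y, f y ≤ Function.update f z (max (f z) 1) y := by
    intro y
    by_cases h : y = z
    · subst h; simp
    · simp [h]
  have h2 : ∀ y, Function.update f z (max (f z) 1) y ≤ 2 := by
    intro y
    by_cases h : y = z
    · subst h; simpa using hf y
    · simpa [h] using hf y
  have hw := weight_update f z (max (f z) 1)
  have hpos : 0 < Function.update f z (max (f z) 1) z := by simp
  by_cases hv : 0 < f v
  · refine ⟨Function.update f z (max (f z) 1), isTRDF_iff.2 ⟨h2, fun x => ?_⟩, by omega,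
      fun _ => by omega⟩
    by_cases h : x = v
    · subst h
      exact ⟨⟨z, hz, hpos⟩, fun h0 => absurd (hle x) (by omega)⟩
    · exact (hoff x h).mono hle h2
  · obtain ⟨g, hg, hgw⟩ := exists_isTRDF_of_pos_neighbour h2 (fun x h => (hoff x h).mono hle h2)
      hz hpos
    exact ⟨g, hg, by omega, fun h => absurd h hv⟩

variable {W : Type*} {H : SimpleGraph W} {v : V} {w : W}

theorem IsTRDF.joinAt_off {f : V ⊕ W → ℕ} (hf : IsTRDF (joinAt G H v w) f) {x : V} (hx : x ≠ v) :
    IsTRDFAt G (fun y => f (Sum.inl y)) x := by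
  refine ⟨?_, fun h0 => ?_⟩
  · obtain ⟨u | u, hu, hfu⟩ := hf.2.1 (Sum.inl x)
    · exact ⟨u, joinAt_inl_inl.1 hu, hfu⟩
    · exact absurd (joinAt_inl_inr.1 hu).1 hx
  · obtain ⟨u | u, hu, hfu⟩ := hf.2.2 (Sum.inl x) h0
    · exact ⟨u, joinAt_inl_inl.1 hu, hfu⟩
    · exact absurd (joinAt_inl_inr.1 hu).1 hx

end Labels

/-! ### Tightness survives the three removals -/

section Reductions

variable {V : Type*} [Fintype V] {G : SimpleGraph V}

/-- Graphs with a total Roman dominating function of weight at most `2 γ(G)`. -/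
def IsTight (G : SimpleGraph V) : Prop :=
  ∃ f, IsTRDF G f ∧ ∀ S, IsDominatingSet G S → weight f ≤ 2 * S.card

theorem IsTight.of_iso {W : Type*} [Fintype W] {H : SimpleGraph W} (h : IsTight G) (e : G ≃g H) :
    IsTight H := by
  obtain ⟨f, hf, hS⟩ := h
  refine ⟨fun y => f (e.symm y), ⟨fun y => hf.1 _, fun y => ?_, fun y hy => ?_⟩, fun S hSd => ?_⟩
  · obtain ⟨u, hu, hfu⟩ := hf.2.1 (e.symm y)
    exact ⟨e u, by rw [← e.apply_symm_apply y]; exact e.map_rel_iff.2 hu, by simpa using hfu⟩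
  · obtain ⟨u, hu, hfu⟩ := hf.2.2 (e.symm y) hy
    exact ⟨e u, by rw [← e.apply_symm_apply y]; exact e.map_rel_iff.2 hu, by simpa using hfu⟩
  · have h1 := hS (S.map e.symm.toEquiv.toEmbedding) fun v hv => by
      have hv' : e v ∉ S := fun h => hv (Finset.mem_map.2 ⟨e v, h, e.symm_apply_apply v⟩)
      obtain ⟨u, hu, huv⟩ := hSd (e v) hv'
      refine ⟨e.symm u, Finset.mem_map.2 ⟨u, hu, rfl⟩, ?_⟩
      rw [← e.map_rel_iff, e.apply_symm_apply]
      exact huv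
    rw [Finset.card_map] at h1
    refine le_trans (le_of_eq ?_) h1
    exact Equiv.sum_comp e.symm.toEquiv f

/-- With two leaves at `v`, weight can be moved onto `v` until it has label 2, without raising the
total. The domination number does not grow with the new leaf, since `v` can replace `y` in a
dominating set. -/
theorem isTight_of_join_leaf (hG : G.IsTree) {v y : V} (hy : ∀ x, G.Adj y x ↔ x = v)
    (hK : IsTight (joinAt G (pathGraph 1) v 0)) : IsTight G ∧ v ∈ supportsTRTwo G := by
  classical
  obtain ⟨f, hf, hfS⟩ := hK
  have hyv : G.Adj y v := (hy v).2 rfl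
  have hne : y ≠ v := hyv.ne
  have hwf := weight_sum f
  have hw1 : weight (fun i : Fin 1 => f (Sum.inr i)) = f (Sum.inr 0) := by simp [weight]
  have hnbr : ∀ u, (joinAt G (pathGraph 1) v 0).Adj (Sum.inl y) u → u = Sum.inl v := by
    rintro (u | u) hu
    · rw [(hy u).1 (joinAt_inl_inl.1 hu)]
    · exact absurd (joinAt_inl_inr.1 hu).1 hne
  have hnbr' : ∀ u, (joinAt G (pathGraph 1) v 0).Adj (Sum.inr 0) u → u = Sum.inl v := by
    rintro (u | u) hu
    · rw [(joinAt_inr_inl.1 hu).1]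
    · exact absurd (Subsingleton.elim _ _) (joinAt_inr_inr.1 hu).ne
  have hfv : 0 < f (Sum.inl v) := by
    obtain ⟨u, hu, h⟩ := hf.2.1 (Sum.inl y)
    rwa [hnbr u hu] at h
  have hy0 : f (Sum.inl y) = 0 → f (Sum.inl v) = 2 := fun h0 => by
    obtain ⟨u, hu, h⟩ := hf.2.2 (Sum.inl y) h0
    rwa [hnbr u hu] at h
  have hx0 : f (Sum.inr 0) = 0 → f (Sum.inl v) = 2 := fun h0 => by
    obtain ⟨u, hu, h⟩ := hf.2.2 (Sum.inr 0) h0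
    rwa [hnbr' u hu] at h
  have hv2 := hf.1 (Sum.inl v)
  -- If both leaves are positive, they and `v` carry at least 3, enough for 2 on `v` and 1 on `y`.
  -- Otherwise `v` already has label 2. A positive `y` takes over the removed leaf's role as
  -- positive neighbour of `v`.
  set k := min 1 (f (Sum.inl y) + f (Sum.inr 0)) with hk
  set g : V → ℕ := Function.update (Function.update (fun x => f (Sum.inl x)) y k) v 2 with hg
  have hgv : g v = 2 := by simp [hg]
  have hgy : g y = k := by simp [hg, hne]
  have hgo : ∀ x, x ≠ v → x ≠ y → g x = f (Sum.inl x) := by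
    intro x h1 h2
    simp [hg, h1, h2]
  have hgpos : ∀ x, 0 < f (Sum.inl x) → 0 < g x := by
    intro x hx
    by_cases h1 : x = v
    · subst h1; omega
    by_cases h2 : x = y
    · subst h2; omega
    rwa [hgo x h1 h2]
  have hgw : weight g ≤ weight f := by
    have h1 := weight_update (Function.update (fun x => f (Sum.inl x)) y k) v 2
    have h2 := weight_update (fun x => f (Sum.inl x)) y k
    rw [Function.update_of_ne hne.symm] at h1
    rw [← hg] at h1
    omega
  have hgT : IsTRDF G g := by
    refine ⟨fun x => ?_, fun x => ?_, fun x hx => ?_⟩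
    · by_cases h1 : x = v
      · subst h1; omega
      by_cases h2 : x = y
      · subst h2; omega
      rw [hgo x h1 h2]
      exact hf.1 _
    · obtain ⟨u | u, hu, hfu⟩ := hf.2.1 (Sum.inl x)
      · exact ⟨u, joinAt_inl_inl.1 hu, hgpos u hfu⟩
      · obtain ⟨rfl, rfl⟩ := joinAt_inl_inr.1 hu
        exact ⟨y, hyv.symm, by omega⟩
    · have h1 : x ≠ v := by rintro rfl; omega
      by_cases h2 : x = y
      · exact ⟨v, h2 ▸ hyv, hgv⟩
      rw [hgo x h1 h2] at hx
      obtain ⟨u, hu, hfu⟩ := (hf.joinAt_off h1).2 hx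
      refine ⟨u, hu, ?_⟩
      by_cases h3 : u = v
      · rw [h3, hgv]
      by_cases h4 : u = y
      · subst h4
        exact absurd ((hy x).1 hu.symm) h1
      · rw [hgo u h3 h4]
        exact hfu
  have hgS : ∀ S, IsDominatingSet G S → weight g ≤ 2 * S.card := by
    intro S hS
    have hD : IsDominatingSet (joinAt G (pathGraph 1) v 0)
        ((insert v (S.erase y)).map Function.Embedding.inl) := by
      rintro (x | x) hx
      · simp only [Finset.mem_map, Function.Embedding.inl_apply, Sum.inl.injEq, exists_eq_right,
          Finset.mem_insert, Finset.mem_erase, not_or, not_and] at hx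
        by_cases h2 : x = y
        · exact ⟨Sum.inl v, by simp, joinAt_inl_inl.2 (h2 ▸ hyv)⟩
        · obtain ⟨u, hu, hxu⟩ := hS x (hx.2 h2)
          refine ⟨Sum.inl u, ?_, joinAt_inl_inl.2 hxu⟩
          have : u ≠ y := by
            rintro rfl
            exact hx.1 ((hy x).1 hxu.symm)
          simp [hu, this]
      · exact ⟨Sum.inl v, by simp, joinAt_inr_inl.2 ⟨rfl, Subsingleton.elim _ _⟩⟩
    have hc := hfS _ hD
    rw [Finset.card_map] at hc
    have : (insert v (S.erase y)).card ≤ S.card := by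
      by_cases h : y ∈ S
      · refine (Finset.card_insert_le _ _).trans ?_
        rw [Finset.card_erase_of_mem h]
        have := Finset.card_pos.2 ⟨y, h⟩
        omega
      · obtain ⟨u, hu, huy⟩ := hS y h
        rw [(hy u).1 huy] at hu
        rw [Finset.erase_eq_of_notMem h, Finset.insert_eq_of_mem hu]
    omega
  refine ⟨⟨g, hgT, hgS⟩, ⟨y, ?_, hyv.symm⟩, g, ⟨hgT, ?_⟩, hgv⟩
  · rw [leaves, Set.mem_ofPred_eq, Set.ncard_eq_one]
    exact ⟨v, Set.ext fun x => hy x⟩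
  -- `g` is optimal: any TRDF weighs at least twice the size of some dominating set, hence at least
  -- as much as `g`.
  · refine le_antisymm ?_ (gammaTR_le hgT)
    obtain ⟨g', hg', hw'⟩ := Nat.sInf_mem (s := {k | ∃ f : V → ℕ, IsTRDF G f ∧ weight f = k})
      ⟨_, g, hgT, rfl⟩
    obtain ⟨D, hD, hDw⟩ := hg'.isTR2DF.exists_dominating hG
    have := hgS D hD
    rw [gammaTR]
    omega

/-- The new path carries at least 2, so the restriction to `G` is light enough; only the conditions
at `v` may fail. They are repaired at no extra cost, or else a dominating set too small for
tightness appears. -/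
theorem exists_isTRDF_of_join_edge {v : V} (hK : (joinAt G (pathGraph 2) v 0).IsTree)
    (hv : (∃ s, ∀ x, G.Adj v x ↔ x = s) ∨
      ∃ s h, G.Adj v s ∧ h ≠ v ∧ ∀ x, G.Adj h x ↔ x = s)
    {f : V ⊕ Fin 2 → ℕ} (hf : IsTRDF (joinAt G (pathGraph 2) v 0) f)
    (hfS : ∀ S, IsDominatingSet (joinAt G (pathGraph 2) v 0) S → weight f ≤ 2 * S.card) :
    ∃ g, IsTRDF G g ∧ weight g + 2 ≤ weight f := by
  classical
  have hwf := weight_sum f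
  have hw2 : weight (fun i : Fin 2 => f (Sum.inr i)) = f (Sum.inr 0) + f (Sum.inr 1) := by
    simp [weight]
  have hnbr : ∀ u, (joinAt G (pathGraph 2) v 0).Adj (Sum.inr 1) u → u = Sum.inr 0 := by
    rintro (u | u) hu
    · exact absurd (joinAt_inr_inl.1 hu).2 (by decide)
    · have := joinAt_inr_inr.1 hu
      fin_cases u
      · rfl
      · exact absurd rfl this.ne
  have hx0 : 0 < f (Sum.inr 0) := by
    obtain ⟨u, hu, h⟩ := hf.2.1 (Sum.inr 1)
    rwa [hnbr u hu] at h
  have hx1 : f (Sum.inr 1) = 0 → f (Sum.inr 0) = 2 := fun h0 => by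
    obtain ⟨u, hu, h⟩ := hf.2.2 (Sum.inr 1) h0
    rwa [hnbr u hu] at h
  have hw0 : (weight fun x => f (Sum.inl x)) + 2 ≤ weight f := by omega
  have hx2 : f (Sum.inl v) = 0 → 0 < f (Sum.inr 1) := fun h0 => by
    obtain ⟨u | u, hu, h⟩ := hf.2.1 (Sum.inr 0)
    · rw [(joinAt_inr_inl.1 hu).1] at h
      omega
    · fin_cases u
      · exact absurd rfl hu.ne
      · exact h
  have hvz : f (Sum.inl v) = 0 → f (Sum.inr 0) ≠ 2 → ∃ u, G.Adj v u ∧ f (Sum.inl u) = 2 := by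
    intro h0 h2
    obtain ⟨u | u, hu, h⟩ := hf.2.2 (Sum.inl v) h0
    · exact ⟨u, joinAt_inl_inl.1 hu, h⟩
    · rw [(joinAt_inl_inr.1 hu).2] at h
      exact absurd h h2
  have hle : ∀ x, f (Sum.inl x) ≤ 2 := fun x => hf.1 _
  have hpos : ∀ s, G.Adj v s → 0 < f (Sum.inl s) → ∃ g, IsTRDF G g ∧ weight g + 2 ≤ weight f := by
    intro s hs hfs
    -- Only here can `v` have lost its neighbour labelled 2. Then the path carries at least 3, and
    -- the spare unit goes to `v`.
    by_cases hc : f (Sum.inl v) = 0 ∧ f (Sum.inr 0) = 2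
    · obtain ⟨g, hg, hgw⟩ := exists_isTRDF_of_pos_neighbour hle
        (fun x hx => hf.joinAt_off hx) hs hfs
      have := hx2 hc.1
      exact ⟨g, hg, by omega⟩
    · refine ⟨fun x => f (Sum.inl x), isTRDF_iff.2 ⟨hle, fun x => ?_⟩, hw0⟩
      by_cases hx : x = v
      · subst hx
        exact ⟨⟨s, hs, hfs⟩, fun h0 => hvz h0 fun h2 => hc ⟨h0, h2⟩⟩
      · exact hf.joinAt_off hx
  rcases hv with ⟨s, hs⟩ | ⟨s, h, hs, hne, hh⟩
  swap
  · refine hpos s hs ?_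
    obtain ⟨u | u, hu, h⟩ := hf.2.1 (Sum.inl h)
    · rwa [(hh u).1 (joinAt_inl_inl.1 hu)] at h
    · exact absurd (joinAt_inl_inr.1 hu).1 hne
  have hvs : G.Adj v s := (hs s).2 rfl
  have hsv : s ≠ v := hvs.ne'
  by_cases hfs : 0 < f (Sum.inl s)
  · exact hpos s hvs hfs
  have hfs0 : f (Sum.inl s) = 0 := by omega
  by_cases hv2 : f (Sum.inl v) = 2
  -- Here `v` is a leaf of `G` and `s` has label 0: the 2 on `v` is split between them.
  · set g : V → ℕ := Function.update (Function.update (fun x => f (Sum.inl x)) s 1) v 1 with hg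
    have hgv : g v = 1 := by simp [hg]
    have hgs : g s = 1 := by simp [hg, hsv]
    have hgo : ∀ x, x ≠ v → x ≠ s → g x = f (Sum.inl x) := by
      intro x h1 h2
      simp [hg, h1, h2]
    refine ⟨g, isTRDF_iff.2 ⟨fun x => ?_, fun x => ?_⟩, ?_⟩
    · by_cases h1 : x = v
      · subst h1; omega
      by_cases h2 : x = s
      · subst h2; omega
      rw [hgo x h1 h2]
      exact hle x
    · by_cases h1 : x = v
      · subst h1
        exact ⟨⟨s, hvs, by omega⟩, fun h => by omega⟩
      by_cases h2 : x = s
      · subst h2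
        exact ⟨⟨v, hvs.symm, by omega⟩, fun h => by omega⟩
      obtain ⟨⟨u, hu, hfu⟩, h2u⟩ := hf.joinAt_off h1
      have hnv : ∀ u, G.Adj x u → u ≠ v := by
        rintro u hu rfl
        exact h2 ((hs x).1 hu.symm)
      have hns : ∀ u, 0 < f (Sum.inl u) → u ≠ s := by
        rintro u hu rfl
        exact hfs hu
      refine ⟨⟨u, hu, ?_⟩, fun h0 => ?_⟩
      · rwa [hgo u (hnv u hu) (hns u hfu)]
      · rw [hgo x h1 h2] at h0
        obtain ⟨z, hz, hfz⟩ := h2u h0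
        refine ⟨z, hz, ?_⟩
        rwa [hgo z (hnv z hz) (hns z (Nat.lt_of_lt_of_eq Nat.two_pos hfz.symm))]
    · have h1 := weight_update (Function.update (fun x => f (Sum.inl x)) s 1) v 1
      have h2 := weight_update (fun x => f (Sum.inl x)) s 1
      rw [Function.update_of_ne hsv.symm] at h1
      rw [← hg] at h1
      omega
  · exfalso
    have h3 : 3 ≤ f (Sum.inr 0) + f (Sum.inr 1) + f (Sum.inl v) := by
      by_cases h0 : f (Sum.inl v) = 0
      · have := hx2 h0
        by_cases h2 : f (Sum.inr 0) = 2
        · omega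
        · obtain ⟨u, hu, hfu⟩ := hvz h0 h2
          rw [(hs u).1 hu] at hfu
          omega
      · omega
    -- Erasing the labels of the path and of `v` frees at least 3 units, yet every other vertex of
    -- `G` keeps closed weight at least 2. Dominating those vertices and adding the path vertex next
    -- to `v` gives a dominating set of size less than half of `weight f`.
    set f' : V ⊕ Fin 2 → ℕ :=
      Sum.elim (Function.update (fun x => f (Sum.inl x)) v 0) (fun _ => 0) with hf'
    have hf'o : ∀ x, x ≠ v → f' (Sum.inl x) = f (Sum.inl x) := by
      intro x hx
      rw [hf', Sum.elim_inl, Function.update_of_ne hx]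
    obtain ⟨D, hD, hDw⟩ := exists_dominating_of_closedWeight hK
      ((Finset.univ.erase v).map Function.Embedding.inl) f' (by
        intro u hu
        obtain ⟨x, hx, rfl⟩ := Finset.mem_map.1 hu
        have hxv : x ≠ v := (Finset.mem_erase.1 hx).1
        obtain ⟨⟨z, hz, hfz⟩, h2⟩ := hf.joinAt_off hxv
        rw [Function.Embedding.inl_apply]
        by_cases h0 : f (Sum.inl x) = 0
        · obtain ⟨z, hz, hfz⟩ := h2 h0
          have hzv : z ≠ v := by rintro rfl; exact hv2 hfz
          refine le_trans ?_ (add_le_closedWeight (joinAt_inl_inl.2 hz))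
          rw [hf'o z hzv]
          dsimp only at hfz
          omega
        · have hzv : z ≠ v := by
            rintro rfl
            rw [(hs x).1 hz.symm] at h0
            exact h0 hfs0
          refine two_le_closedWeight_of_pos (joinAt_inl_inl.2 hz) ?_ ?_
          · rw [hf'o x hxv]; omega
          · rwa [hf'o z hzv])
    have hDD := hfS (insert (Sum.inr 0) D) (by
      rintro (x | x) hx
      · by_cases hxv : x = v
        · exact ⟨Sum.inr 0, Finset.mem_insert_self _ _, joinAt_inl_inr.2 ⟨hxv, rfl⟩⟩
        · obtain ⟨d, hd, hxd⟩ := hD (Sum.inl x) (by simp [hxv])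
            fun h => hx (Finset.mem_insert_of_mem h)
          exact ⟨d, Finset.mem_insert_of_mem hd, hxd⟩
      · fin_cases x
        · exact absurd (Finset.mem_insert_self _ _) hx
        · exact ⟨Sum.inr 0, Finset.mem_insert_self _ _, joinAt_inr_inr.2 (pathGraph_adj.2 (by decide))⟩)
    have hcard := Finset.card_insert_le (Sum.inr 0) D
    have hw' : weight f' + f (Sum.inl v) = weight (fun x => f (Sum.inl x)) := by
      have h1 := weight_update (fun x => f (Sum.inl x)) v 0
      have h2 : weight f' = weight (Function.update (fun x => f (Sum.inl x)) v 0) +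
          weight fun _ : Fin 2 => 0 := weight_sum f'
      have h0 : weight (fun _ : Fin 2 => 0) = 0 := Finset.sum_const_zero
      omega
    omega

theorem nbrWeight_joinAt_inl {W : Type*} [Fintype W] {H : SimpleGraph W} {v : V} {w : W}
    (f : V ⊕ W → ℕ) (x : V) :
    nbrWeight G (fun y => f (Sum.inl y)) x ≤ nbrWeight (joinAt G H v w) f (Sum.inl x) := by
  classical
  simp only [nbrWeight, Finset.sum_filter, Fintype.sum_sum_type, joinAt_inl_inl]
  exact Nat.le_add_right _ _

theorem nbrWeight_joinAt_self {W : Type*} [Fintype W] {H : SimpleGraph W} {v : V} {w : W}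
    (f : V ⊕ W → ℕ) :
    nbrWeight (joinAt G H v w) f (Sum.inl v) =
      nbrWeight G (fun y => f (Sum.inl y)) v + f (Sum.inr w) := by
  classical
  simp [nbrWeight, Finset.sum_filter, Fintype.sum_sum_type]

/-- The two new vertices serve each other, and the one next to `v` supplies the single unit that `v`
may lack. -/
theorem IsNearTR2DF.joinAt_edge {v : V} {h : V → ℕ} (hh : IsNearTR2DF G v h) :
    IsTR2DF (joinAt G (pathGraph 2) v 0) (Sum.elim h fun _ => 1) := by
  have htd : IsTDF (joinAt G (pathGraph 2) v 0) (Sum.elim h fun _ => 1) := by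
    rintro (x | i)
    · have : ∃ u, G.Adj x u ∧ 0 < h u := by
        by_cases h0 : h x = 0
        · apply exists_pos_of_nbrWeight_pos
          by_cases hx : x = v
          · subst hx
            exact hh.2.1 h0
          · exact lt_of_lt_of_le (by omega) (hh.2.2.1 x hx h0)
        · exact hh.2.2.2 x (by omega)
      obtain ⟨u, hu, hu'⟩ := this
      exact ⟨Sum.inl u, joinAt_inl_inl.2 hu, hu'⟩
    · fin_cases i
      · exact ⟨Sum.inr 1, joinAt_inr_inr.2 (pathGraph_adj.2 (by decide)), by simp⟩
      · exact ⟨Sum.inr 0, joinAt_inr_inr.2 (pathGraph_adj.2 (by decide)), by simp⟩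
  refine ⟨⟨?_, fun v _ => htd v, ?_⟩, htd⟩
  · rintro (x | i)
    · exact hh.1 x
    · simp
  · rintro (x | i) h0
    · by_cases hx : x = v
      · subst hx
        rw [nbrWeight_joinAt_self]
        exact Nat.add_le_add_right (hh.2.1 h0) 1
      · exact (hh.2.2.1 x hx h0).trans (nbrWeight_joinAt_inl (Sum.elim h fun _ => 1) x)
    · simp at h0

theorem IsTR2DF.isNearTR2DF {v : V} {f : V → ℕ} (hf : IsTR2DF G f) : IsNearTR2DF G v f :=
  ⟨hf.1.1, fun h => le_trans (by omega) (hf.1.2.2 v h), fun u _ h => hf.1.2.2 u h,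
    fun u _ => hf.2 u⟩

/-- Near stability: a near-TR2DF lighter than the TRDF found on `G` would extend by two units to a
TR2DF of the join, hence give a dominating set that contradicts tightness. -/
theorem isTight_of_join_edge {v : V} (hK : (joinAt G (pathGraph 2) v 0).IsTree)
    (hv : (∃ s, ∀ x, G.Adj v x ↔ x = s) ∨
      ∃ s h, G.Adj v s ∧ h ≠ v ∧ ∀ x, G.Adj h x ↔ x = s)
    (ht : IsTight (joinAt G (pathGraph 2) v 0)) : IsTight G ∧ IsNearStable G v := by
  classical
  obtain ⟨f, hf, hfS⟩ := ht
  obtain ⟨g, hg, hgf⟩ := exists_isTRDF_of_join_edge hK hv hf hfS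
  refine ⟨⟨g, hg, fun S hS => ?_⟩, ?_⟩
  · have := hfS (insert (Sum.inr 0) (S.map Function.Embedding.inl)) (by
      rintro (x | i) hx
      · obtain ⟨d, hd, hxd⟩ := hS x fun h => hx (by simp [h])
        exact ⟨Sum.inl d, by simp [hd], joinAt_inl_inl.2 hxd⟩
      · fin_cases i
        · exact absurd (Finset.mem_insert_self _ _) hx
        · exact ⟨Sum.inr 0, Finset.mem_insert_self _ _, joinAt_inr_inr.2 (pathGraph_adj.2 (by decide))⟩)
    have hc := Finset.card_insert_le (Sum.inr 0 : V ⊕ Fin 2) (S.map Function.Embedding.inl)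
    rw [Finset.card_map] at hc
    omega
  · obtain ⟨f₀, hf₀, hw₀⟩ := exists_isGammaTR2Function ⟨g, hg.isTR2DF⟩
    refine le_antisymm (Nat.sInf_le ⟨f₀, hf₀.isNearTR2DF, hw₀⟩) ?_
    obtain ⟨h, hh, hhw⟩ :=
      Nat.sInf_mem (s := {k | ∃ f : V → ℕ, IsNearTR2DF G v f ∧ weight f = k})
      ⟨_, f₀, hf₀.isNearTR2DF, rfl⟩
    obtain ⟨D, hD, hDw⟩ := hh.joinAt_edge.exists_dominating hK
    have h1 := hfS D hD
    have h2 := gammaTR2_le hg.isTR2DF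
    have h3 : weight (Sum.elim h fun _ : Fin 2 => 1) = weight h + 2 := by
      simp [weight]
    rw [gammaNearTR2]
    omega

theorem treeR_none_some {r : ℕ} {i : Fin r} {j : Fin 4} :
    (treeR r).Adj none (some (i, j)) ↔ j = 1 := by
  simp [treeR]

theorem treeR_some_some {r : ℕ} {i i' : Fin r} {j j' : Fin 4} :
    (treeR r).Adj (some (i, j)) (some (i', j')) ↔ i = i' ∧ (pathGraph 4).Adj j j' := by
  simp only [treeR, fromRel_adj, ne_eq, Option.some.injEq, Prod.mk.injEq]
  constructor
  · rintro ⟨-, h | h⟩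
    · exact h
    · exact ⟨h.1.symm, h.2.symm⟩
  · rintro ⟨rfl, h⟩
    exact ⟨fun h' => h.ne h'.2, Or.inl ⟨rfl, h⟩⟩

/-- Each copy of P_4 carries weight at least 4, while its two support vertices extend a dominating
set of `G`; the label of the centre pays for the repair at `v`. -/
theorem isTight_of_join_treeR {v z : V} {r : ℕ} (hr : 1 ≤ r) (hz : G.Adj v z)
    (ht : IsTight (joinAt G (treeR r) v none)) : IsTight G := by
  classical
  obtain ⟨f, hf, hfS⟩ := ht
  have hle : ∀ x, f (Sum.inl x) ≤ 2 := fun x => hf.1 _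
  have hwf := weight_sum f
  have hend : ∀ (i : Fin r) (j k : Fin 4),
      (∀ j', (pathGraph 4).Adj j j' → j' = k) → j ≠ 1 →
      2 ≤ f (Sum.inr (some (i, j))) + f (Sum.inr (some (i, k))) := by
    intro i j k hjk hj
    have hnbr : ∀ u, (joinAt G (treeR r) v none).Adj (Sum.inr (some (i, j))) u →
        u = Sum.inr (some (i, k)) := by
      rintro (u | _ | ⟨i', j'⟩) hu
      · simp at hu
      · exact absurd (treeR_none_some.1 (joinAt_inr_inr.1 hu).symm) hj
      · obtain ⟨rfl, h⟩ := treeR_some_some.1 (joinAt_inr_inr.1 hu)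
        rw [hjk j' h]
    obtain ⟨u, hu, hfu⟩ := hf.2.1 (Sum.inr (some (i, j)))
    rw [hnbr u hu] at hfu
    by_cases h0 : f (Sum.inr (some (i, j))) = 0
    · obtain ⟨u', hu', hfu'⟩ := hf.2.2 _ h0
      rw [hnbr u' hu'] at hfu'
      omega
    · omega
  have hwr : f (Sum.inr none) + 4 * r ≤ weight fun y => f (Sum.inr y) := by
    unfold weight
    rw [Fintype.sum_option, Fintype.sum_prod_type]
    refine Nat.add_le_add_left ?_ _
    calc 4 * r = ∑ _i : Fin r, 4 := by simp [mul_comm]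
      _ ≤ _ := Finset.sum_le_sum fun i _ => by
        rw [Fin.sum_univ_four]
        have h1 := hend i 0 1 (by simp only [pathGraph_adj]; decide) (by decide)
        have h2 := hend i 3 2 (by simp only [pathGraph_adj]; decide) (by decide)
        omega
  have hg : ∃ g, IsTRDF G g ∧ weight g + 4 * r ≤ weight f := by
    have hcv : ∀ u, (joinAt G (treeR r) v none).Adj (Sum.inl v) u → f u ≠ f (Sum.inr none) →
        ∃ y, u = Sum.inl y ∧ G.Adj v y := by
      rintro (u | u) hu h
      · exact ⟨u, rfl, joinAt_inl_inl.1 hu⟩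
      · rw [(joinAt_inl_inr.1 hu).2] at h
        exact absurd rfl h
    have hc2 := hf.1 (Sum.inr none)
    by_cases hc : f (Sum.inr none) = 0
    · refine ⟨fun x => f (Sum.inl x), isTRDF_iff.2 ⟨hle, fun x => ?_⟩, by omega⟩
      by_cases hx : x = v
      · subst hx
        refine ⟨?_, fun h0 => ?_⟩
        · obtain ⟨u, hu, hfu⟩ := hf.2.1 (Sum.inl x)
          obtain ⟨y, rfl, hy⟩ := hcv u hu (by omega)
          exact ⟨y, hy, hfu⟩
        · obtain ⟨u, hu, hfu⟩ := hf.2.2 (Sum.inl x) h0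
          obtain ⟨y, rfl, hy⟩ := hcv u hu (by omega)
          exact ⟨y, hy, hfu⟩
      · exact hf.joinAt_off hx
    -- The repair costs 1 if `v` is positive and at most 2 if not. In the remaining case the centre
    -- has label 1 and `v` label 0, so `v` has a neighbour labelled 2 inside `G` and one unit
    -- suffices.
    · obtain ⟨g, hg, hg2, hg1⟩ := exists_isTRDF_of_neighbour hle (fun x hx => hf.joinAt_off hx) hz
      by_cases hv : 0 < f (Sum.inl v)
      · exact ⟨g, hg, by have := hg1 hv; omega⟩
      · by_cases hc2 : f (Sum.inr none) = 2
        · exact ⟨g, hg, by omega⟩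
        · obtain ⟨u, hu, hfu⟩ := hf.2.2 (Sum.inl v) (by omega)
          obtain ⟨y, rfl, hy⟩ := hcv u hu (by omega)
          obtain ⟨g', hg', hgw'⟩ := exists_isTRDF_of_pos_neighbour hle
            (fun x hx => hf.joinAt_off hx) hy (by omega)
          exact ⟨g', hg', by omega⟩
  obtain ⟨g, hg, hgf⟩ := hg
  refine ⟨g, hg, fun S hS => ?_⟩
  let R : Finset (V ⊕ Option (Fin r × Fin 4)) :=
    (Finset.univ : Finset (Fin r × Fin 2)).image fun p => Sum.inr (some (p.1, ![1, 2] p.2))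
  have hR : R.card ≤ 2 * r := by
    refine Finset.card_image_le.trans ?_
    simp [mul_comm]
  have hR1 : ∀ i, Sum.inr (some (i, 1)) ∈ R := fun i =>
    Finset.mem_image.2 ⟨(i, 0), Finset.mem_univ _, rfl⟩
  have hR2 : ∀ i, Sum.inr (some (i, 2)) ∈ R := fun i =>
    Finset.mem_image.2 ⟨(i, 1), Finset.mem_univ _, rfl⟩
  have hS' := hfS (S.map Function.Embedding.inl ∪ R) (by
    rintro (x | _ | ⟨i, j⟩) hx
    · obtain ⟨d, hd, hxd⟩ := hS x fun h => hx (by simp [h])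
      exact ⟨Sum.inl d, by simp [hd], joinAt_inl_inl.2 hxd⟩
    · exact ⟨Sum.inr (some (⟨0, hr⟩, 1)), Finset.mem_union_right _ (hR1 _),
        joinAt_inr_inr.2 (treeR_none_some.2 rfl)⟩
    · fin_cases j
      · exact ⟨Sum.inr (some (i, 1)), Finset.mem_union_right _ (hR1 _),
          joinAt_inr_inr.2 (treeR_some_some.2 ⟨rfl, pathGraph_adj.2 (by decide)⟩)⟩
      · exact absurd (Finset.mem_union_right _ (hR1 i)) hx
      · exact absurd (Finset.mem_union_right _ (hR2 i)) hx
      · exact ⟨Sum.inr (some (i, 2)), Finset.mem_union_right _ (hR2 _),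
          joinAt_inr_inr.2 (treeR_some_some.2 ⟨rfl, pathGraph_adj.2 (by decide)⟩)⟩)
  have hc := Finset.card_union_le (S.map Function.Embedding.inl) R
  rw [Finset.card_map] at hc
  omega

end Reductions

/-! ### Cutting a tree at an edge -/

section Splitting

variable {V W : Type*} {T : SimpleGraph V} {H : SimpleGraph W} (φ : H ↪g T) {v : V} {w : W}

theorem nonempty_iso_joinAt (hv : v ∈ (Set.range φ)ᶜ)
    (h : ∀ x ∈ (Set.range φ)ᶜ, ∀ y, T.Adj x (φ y) ↔ x = v ∧ y = w) :
    Nonempty (T ≃g joinAt (T.induce (Set.range φ)ᶜ) H ⟨v, hv⟩ w) := by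
  let F : ((Set.range φ)ᶜ : Set V) ⊕ W → V := Sum.elim Subtype.val φ
  have hF : Function.Bijective F := by
    constructor
    · rintro (⟨x, hx⟩ | x) (⟨y, hy⟩ | y) hxy
      · exact congrArg Sum.inl (Subtype.ext hxy)
      · exact absurd ⟨y, hxy.symm⟩ hx
      · exact absurd ⟨x, hxy⟩ hy
      · exact congrArg Sum.inr (φ.injective hxy)
    · intro x
      by_cases hx : x ∈ Set.range φ
      · obtain ⟨y, rfl⟩ := hx
        exact ⟨Sum.inr y, rfl⟩
      · exact ⟨Sum.inl ⟨x, hx⟩, rfl⟩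
  refine ⟨(RelIso.mk (Equiv.ofBijective F hF) ?_ :
    joinAt (T.induce (Set.range φ)ᶜ) H ⟨v, hv⟩ w ≃g T).symm⟩
  rintro (⟨x, hx⟩ | x) (⟨y, hy⟩ | y)
  · rw [joinAt_inl_inl]
    exact Iff.rfl
  · rw [joinAt_inl_inr, Subtype.mk.injEq]
    exact h x hx y
  · rw [joinAt_inr_inl, Subtype.mk.injEq]
    exact (T.adj_comm _ _).trans (h y hy x)
  · rw [joinAt_inr_inr]
    exact φ.map_rel_iff

/-- Collapsing the range of `φ` onto `v` sends walks of `T` to walks of the remainder, which gives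
connectedness. -/
theorem isTree_induce_compl_range (hT : T.IsTree) (hv : v ∈ (Set.range φ)ᶜ)
    (h : ∀ x ∈ (Set.range φ)ᶜ, ∀ y, T.Adj x (φ y) ↔ x = v ∧ y = w) :
    (T.induce (Set.range φ)ᶜ).IsTree := by
  classical
  let π : V → ((Set.range φ)ᶜ : Set V) := fun x => if hx : x ∈ (Set.range φ)ᶜ then ⟨x, hx⟩ else ⟨v, hv⟩
  have hin : ∀ x (hx : x ∈ (Set.range φ)ᶜ), π x = ⟨x, hx⟩ := fun x hx => dif_pos hx
  have hout : ∀ x, x ∉ (Set.range φ)ᶜ → π x = ⟨v, hv⟩ := fun x hx => dif_neg hx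
  have hcross : ∀ x y, x ∈ (Set.range φ)ᶜ → y ∉ (Set.range φ)ᶜ → T.Adj x y → π x = π y := by
    intro x y hx hy hxy
    rw [hin x hx, hout y hy]
    obtain ⟨z, rfl⟩ := not_not.1 hy
    exact Subtype.ext ((h x hx z).1 hxy).1
  have hadj : ∀ x y, T.Adj x y → (T.induce (Set.range φ)ᶜ).Reachable (π x) (π y) := by
    intro x y hxy
    by_cases hx : x ∈ (Set.range φ)ᶜ <;> by_cases hy : y ∈ (Set.range φ)ᶜ
    · rw [hin x hx, hin y hy]
      exact Adj.reachable hxy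
    · rw [hcross x y hx hy hxy]
    · rw [hcross y x hy hx hxy.symm]
    · rw [hout x hx, hout y hy]
  have hreach : ∀ {x y} (_ : T.Walk x y), (T.induce (Set.range φ)ᶜ).Reachable (π x) (π y) := by
    intro x y p
    induction p with
    | nil => exact Reachable.refl _
    | cons hxy _ ih => exact (hadj _ _ hxy).trans ih
  refine ⟨(connected_iff _).2 ⟨?_, ⟨⟨v, hv⟩⟩⟩, hT.2.induce _⟩
  rintro ⟨x, hx⟩ ⟨y, hy⟩
  obtain ⟨p⟩ := hT.1.preconnected x y
  rw [← hin x hx, ← hin y hy]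
  exact hreach p

end Splitting

/-- `s` is the only neighbour of `x`. -/
def IsLeafAt {V : Type*} (T : SimpleGraph V) (x s : V) : Prop :=
  ∀ z, T.Adj x z ↔ z = s

theorem IsLeafAt.mem_leaves {V : Type*} [Fintype V] {T : SimpleGraph V} {x s : V}
    (h : IsLeafAt T x s) : x ∈ leaves T := by
  rw [leaves, Set.mem_ofPred_eq, Set.ncard_eq_one]
  exact ⟨s, Set.ext h⟩

/-! ### Locating a removable piece and the induction -/

section Steps

variable {V : Type u} [Fintype V] {T : SimpleGraph V}

/-- Every proper induced tight subtree with at least two vertices belongs to the family `𝓕`. -/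
def SubtreesInFamily (T : SimpleGraph V) : Prop :=
  ∀ (s : Set V) [Fintype s], s ≠ Set.univ → (T.induce s).IsTree → Nontrivial s →
    IsTight (T.induce s) → FamilyF (T.induce s)

theorem familyF_of_join (hT : T.IsTree) (ht : IsTight T) (ih : SubtreesInFamily T) {W : Type*}
    [Fintype W] {H : SimpleGraph W} (φ : H ↪g T) {v : V} {w : W} (hv : v ∈ (Set.range φ)ᶜ)
    (h : ∀ x ∈ (Set.range φ)ᶜ, ∀ y, T.Adj x (φ y) ↔ x = v ∧ y = w)
    (hz : ∃ z ∈ (Set.range φ)ᶜ, z ≠ v)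
    (hstep : ∀ [Fintype ((Set.range φ)ᶜ : Set V)], (T.induce (Set.range φ)ᶜ).IsTree →
      (joinAt (T.induce (Set.range φ)ᶜ) H ⟨v, hv⟩ w).IsTree →
      IsTight (joinAt (T.induce (Set.range φ)ᶜ) H ⟨v, hv⟩ w) →
      IsTight (T.induce (Set.range φ)ᶜ) ∧
        (Nonempty (T ≃g joinAt (T.induce (Set.range φ)ᶜ) H ⟨v, hv⟩ w) →
          IsStep (T.induce (Set.range φ)ᶜ) T)) : FamilyF T := by
  classical
  obtain ⟨e⟩ := nonempty_iso_joinAt φ hv h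
  have hT' := isTree_induce_compl_range φ hT hv h
  obtain ⟨h1, h2⟩ := hstep hT' (e.isTree_iff.1 hT) (ht.of_iso e)
  obtain ⟨z, hz, hzv⟩ := hz
  refine FamilyF.step _ _ (ih _ ?_ hT' ⟨⟨⟨z, hz⟩, ⟨v, hv⟩, fun h => hzv (congrArg Subtype.val h)⟩⟩ h1)
    (h2 ⟨e⟩)
  intro hu
  have : φ w ∈ (Set.range φ)ᶜ := hu ▸ Set.mem_univ _
  exact this ⟨w, rfl⟩

theorem familyF_of_two_leaves (hT : T.IsTree) (ht : IsTight T) (ih : SubtreesInFamily T)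
    {v x y : V} (hxy : x ≠ y) (hx : IsLeafAt T x v) (hy : IsLeafAt T y v) : FamilyF T := by
  have hxv : T.Adj x v := (hx v).2 rfl
  have hyv : T.Adj y v := (hy v).2 rfl
  let φ : pathGraph 1 ↪g T :=
    { toFun := fun _ => x
      inj' := fun _ _ _ => Subsingleton.elim _ _
      map_rel_iff' := by
        intro a b
        refine ⟨fun h => absurd rfl h.ne, fun h => absurd (Subsingleton.elim a b) h.ne⟩ }
  have hr : ∀ z, z ∈ (Set.range φ)ᶜ ↔ z ≠ x := fun z =>
    ⟨fun h h' => h ⟨0, h'.symm⟩, fun h ⟨_, h'⟩ => h h'.symm⟩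
  refine familyF_of_join hT ht ih φ (v := v) (w := 0) ((hr v).2 hxv.ne') ?_
    ⟨y, (hr y).2 hxy.symm, hyv.ne⟩ ?_
  · intro z _ i
    exact (T.adj_comm _ _).trans ((hx z).trans ⟨fun h => ⟨h, Subsingleton.elim _ _⟩, And.left⟩)
  · intro _ hG _ htK
    obtain ⟨h1, h2⟩ := isTight_of_join_leaf hG (y := ⟨y, (hr y).2 hxy.symm⟩)
      (fun z => (hy z).trans ⟨fun h => Subtype.ext h, congrArg Subtype.val⟩) htK
    exact ⟨h1, fun e => Or.inr (Or.inl ⟨_, h2, e⟩)⟩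

theorem familyF_of_pendant_edge (hT : T.IsTree) (ht : IsTight T) (ih : SubtreesInFamily T)
    {v₀ v₁ v₂ : V} (hne : v₀ ≠ v₂) (h0 : IsLeafAt T v₀ v₁)
    (h1 : ∀ z, T.Adj v₁ z ↔ z = v₀ ∨ z = v₂)
    (h2 : (∃ s, s ≠ v₁ ∧ ∀ z, T.Adj v₂ z ↔ z = v₁ ∨ z = s) ∨
      ∃ s h, s ≠ v₁ ∧ T.Adj v₂ s ∧ h ≠ v₂ ∧ IsLeafAt T h s) : FamilyF T := by
  have h01 : T.Adj v₀ v₁ := (h0 _).2 rfl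
  have h12 : T.Adj v₁ v₂ := (h1 _).2 (Or.inr rfl)
  let φ : pathGraph 2 ↪g T :=
    { toFun := ![v₁, v₀]
      inj' := by
        intro a b h
        fin_cases a <;> fin_cases b
        · rfl
        · exact absurd h h01.ne'
        · exact absurd h h01.ne
        · rfl
      map_rel_iff' := by
        intro a b
        rw [pathGraph_adj]
        fin_cases a <;> fin_cases b
        · exact ⟨fun h => absurd rfl h.ne, fun h => absurd h (by decide)⟩
        · exact ⟨fun _ => by decide, fun _ => h01.symm⟩
        · exact ⟨fun _ => by decide, fun _ => h01⟩
        · exact ⟨fun h => absurd rfl h.ne, fun h => absurd h (by decide)⟩ }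
  have hr : ∀ z, z ∈ (Set.range φ)ᶜ ↔ z ≠ v₁ ∧ z ≠ v₀ := by
    refine fun z => ⟨fun h => ⟨fun h' => h ⟨0, h'.symm⟩, fun h' => h ⟨1, h'.symm⟩⟩, ?_⟩
    rintro ⟨h, h'⟩ ⟨i, hi⟩
    fin_cases i
    · exact h hi.symm
    · exact h' hi.symm
  have hv2 : v₂ ∈ (Set.range φ)ᶜ := (hr _).2 ⟨h12.ne', hne.symm⟩
  have hs : ∀ s, s ≠ v₁ → T.Adj v₂ s → s ∈ (Set.range φ)ᶜ := by
    refine fun s hs hvs => (hr s).2 ⟨hs, ?_⟩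
    rintro rfl
    exact h12.ne' ((h0 _).1 hvs.symm)
  refine familyF_of_join hT ht ih φ (v := v₂) (w := 0) hv2 ?_ ?_ ?_
  · intro z hz i
    obtain ⟨hz1, hz0⟩ := (hr z).1 hz
    rw [T.adj_comm]
    fin_cases i
    · exact (h1 z).trans ⟨fun h => ⟨h.resolve_left hz0, rfl⟩, fun h => Or.inr h.1⟩
    · exact (h0 z).trans ⟨fun h => absurd h hz1, fun h => absurd h.2 (by decide)⟩
  · rcases h2 with ⟨s, hs1, h2⟩ | ⟨s, h, hs1, hs2, -⟩
    · have hs2 := (h2 s).2 (Or.inr rfl)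
      exact ⟨s, hs s hs1 hs2, hs2.ne'⟩
    · exact ⟨s, hs s hs1 hs2, hs2.ne'⟩
  · intro _ hG hK htK
    have hcond : (∃ s, IsLeafAt (T.induce (Set.range φ)ᶜ) ⟨v₂, hv2⟩ s) ∨
        ∃ s h, (T.induce (Set.range φ)ᶜ).Adj ⟨v₂, hv2⟩ s ∧ h ≠ ⟨v₂, hv2⟩ ∧
          IsLeafAt (T.induce (Set.range φ)ᶜ) h s := by
      rcases h2 with ⟨s, hs1, h2⟩ | ⟨s, h, hs1, hs2, hhv, hh⟩
      · refine Or.inl ⟨⟨s, hs s hs1 ((h2 s).2 (Or.inr rfl))⟩, fun z => (h2 z).trans ?_⟩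
        rw [Subtype.ext_iff]
        exact ⟨fun h => h.resolve_left ((hr z).1 z.2).1, Or.inr⟩
      · have hhr : h ∈ (Set.range φ)ᶜ := by
          refine (hr h).2 ⟨?_, ?_⟩
          · rintro rfl
            exact hne (((hh _).1 h01.symm).trans ((hh _).1 h12).symm)
          · rintro rfl
            exact hs1 ((hh _).1 h01).symm
        exact Or.inr ⟨⟨s, hs s hs1 hs2⟩, ⟨h, hhr⟩, hs2, fun h' => hhv (congrArg Subtype.val h'),
          fun z => (hh z).trans ⟨fun h => Subtype.ext h, congrArg Subtype.val⟩⟩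
    obtain ⟨h1, h2⟩ := isTight_of_join_edge hK hcond htK
    refine ⟨h1, fun e => ?_⟩
    have hmem : (⟨v₂, hv2⟩ : ((Set.range φ)ᶜ : Set V)) ∈
        leaves (T.induce (Set.range φ)ᶜ) ∪ semiSupports (T.induce (Set.range φ)ᶜ) := by
      by_cases hl : (⟨v₂, hv2⟩ : ((Set.range φ)ᶜ : Set V)) ∈ leaves (T.induce (Set.range φ)ᶜ)
      · exact Or.inl hl
      · rcases hcond with ⟨s, hs⟩ | ⟨s, h, hs, -, hh⟩
        · exact absurd hs.mem_leaves hl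
        · exact Or.inr ⟨hl, s, ⟨h, hh.mem_leaves, ((hh s).2 rfl).symm⟩, hs⟩
    exact Or.inr (Or.inr (Or.inr (Or.inr (Or.inr (Or.inl ⟨_, hmem, h2, e⟩)))))

/-- The depth `d` is there to tell the named vertices apart: together with the neighbourhoods it
makes the copy of R_r injective and disjoint from `v`. -/
theorem familyF_of_treeR (hT : T.IsTree) (ht : IsTight T) (ih : SubtreesInFamily T) {d : V → ℕ}
    {r : ℕ} (hr : 1 ≤ r) {u v : V} {w l c e : Fin r → V} (hw : Function.Injective w)
    (hu : ∀ z, T.Adj u z ↔ z = v ∨ ∃ i, z = w i)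
    (hwN : ∀ i z, T.Adj (w i) z ↔ z = u ∨ z = l i ∨ z = c i)
    (hlN : ∀ i, IsLeafAt T (l i) (w i)) (hcN : ∀ i z, T.Adj (c i) z ↔ z = e i ∨ z = w i)
    (heN : ∀ i, IsLeafAt T (e i) (c i)) (dv : d u = d v + 1) (dw : ∀ i, d (w i) = d u + 1)
    (dl : ∀ i, d (l i) = d u + 2) (dc : ∀ i, d (c i) = d u + 2) (de : ∀ i, d (e i) = d u + 3)
    (hz : ∃ z, T.Adj v z ∧ z ≠ u) : FamilyF T := by
  let F : Option (Fin r × Fin 4) → V := fun a =>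
    match a with
    | none => u
    | some (i, j) => ![l i, w i, c i, e i] j
  -- Depth alone does not separate `l` from `c`; the deeper neighbour `e j` of `c j` does.
  have hlc : ∀ i j, l i ≠ c j := by
    intro i j h
    have h1 := (hlN i (e j)).1 (h ▸ (hcN j _).2 (Or.inl rfl))
    have h2 := congrArg d h1
    rw [de, dw] at h2
    omega
  have hcc : ∀ i j, c i = c j → i = j := by
    intro i j h
    have h1 : T.Adj (c i) (w j) := h ▸ (hcN j _).2 (Or.inr rfl)
    rcases (hcN i _).1 h1 with h2 | h2
    · have h3 := congrArg d h2
      rw [de, dw] at h3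
      omega
    · exact hw h2.symm
  have hll : ∀ i j, l i = l j → i = j := fun i j h =>
    hw ((hlN j _).1 (h ▸ (hlN i _).2 rfl))
  have hee : ∀ i j, e i = e j → i = j := fun i j h =>
    hcc i j ((heN j _).1 (h ▸ (heN i _).2 rfl))
  have hF1 : ∀ i, F (some (i, 1)) = w i := fun _ => rfl
  have hFd : ∀ i j, d (F (some (i, j))) = d u + ![2, 1, 2, 3] j := by
    intro i j
    fin_cases j
    · exact dl i
    · exact dw i
    · exact dc i
    · exact de i
  have hpos : ∀ j : Fin 4, 0 < ![2, 1, 2, 3] j := by decide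
  have hFinj : Function.Injective F := by
    rintro (_ | ⟨i, j⟩) (_ | ⟨i', j'⟩) h
    · rfl
    · have h1 := congrArg d h
      rw [hFd] at h1
      have := hpos j'
      change d u = _ at h1
      omega
    · have h1 := congrArg d h
      rw [hFd] at h1
      have := hpos j
      change _ = d u at h1
      omega
    · have h1 := congrArg d h
      rw [hFd, hFd] at h1
      have h2 : ![2, 1, 2, 3] j = ![2, 1, 2, 3] j' := by omega
      fin_cases j <;> fin_cases j' <;> first
        | exact absurd h2 (by decide)
        | exact absurd h (hlc _ _)
        | exact absurd h.symm (hlc _ _)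
        | rw [hll _ _ h]
        | rw [hw h]
        | rw [hcc _ _ h]
        | rw [hee _ _ h]
  have hFv : ∀ a, F a ≠ v := by
    rintro (_ | ⟨i, j⟩) h
    · have h1 := congrArg d h
      change d u = _ at h1
      omega
    · have h1 := congrArg d h
      rw [hFd] at h1
      omega
  have hnone : ∀ b, T.Adj u (F b) ↔ (treeR r).Adj none b := by
    intro b
    rw [hu, or_iff_right (hFv b)]
    rcases b with _ | ⟨i, j⟩
    · refine ⟨?_, fun h => absurd rfl h.ne⟩
      rintro ⟨i, h⟩
      exact absurd (@hFinj none (some (i, 1)) h) (by simp)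
    · rw [treeR_none_some]
      constructor
      · rintro ⟨i', h⟩
        have := @hFinj (some (i, j)) (some (i', 1)) h
        simp only [Option.some.injEq, Prod.mk.injEq] at this
        exact this.2
      · rintro rfl
        exact ⟨i, hF1 i⟩
  have hsome : ∀ i j z, T.Adj (F (some (i, j))) z ↔ ∃ b, z = F b ∧ (treeR r).Adj (some (i, j)) b := by
    have hadj : ∀ (i : Fin r) (j j' : Fin 4), (j.val + 1 = j'.val ∨ j'.val + 1 = j.val) →
        (treeR r).Adj (some (i, j)) (some (i, j')) := fun i j j' h =>
      treeR_some_some.2 ⟨rfl, pathGraph_adj.2 h⟩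
    intro i j z
    constructor
    · intro h
      fin_cases j
      · exact ⟨some (i, 1), (hlN i z).1 h, hadj _ _ _ (by decide)⟩
      · rcases (hwN i z).1 h with h | h | h
        · exact ⟨none, h, (treeR_none_some.2 rfl).symm⟩
        · exact ⟨some (i, 0), h, hadj _ _ _ (by decide)⟩
        · exact ⟨some (i, 2), h, hadj _ _ _ (by decide)⟩
      · rcases (hcN i z).1 h with h | h
        · exact ⟨some (i, 3), h, hadj _ _ _ (by decide)⟩
        · exact ⟨some (i, 1), h, hadj _ _ _ (by decide)⟩
      · exact ⟨some (i, 2), (heN i z).1 h, hadj _ _ _ (by decide)⟩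
    · rintro ⟨b, rfl, hb⟩
      rcases b with _ | ⟨i', j'⟩
      · exact ((hnone _).2 hb.symm).symm
      · obtain ⟨rfl, h⟩ := treeR_some_some.1 hb
        have h' := pathGraph_adj.1 h
        fin_cases j <;> fin_cases j' <;> first
          | exact absurd h' (by decide)
          | exact (hlN i _).2 rfl
          | exact (hwN i _).2 (Or.inr (Or.inl rfl))
          | exact (hwN i _).2 (Or.inr (Or.inr rfl))
          | exact (hcN i _).2 (Or.inl rfl)
          | exact (hcN i _).2 (Or.inr rfl)
          | exact (heN i _).2 rfl
  let φ : treeR r ↪g T :=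
    { toFun := F
      inj' := hFinj
      map_rel_iff' := by
        rintro (_ | ⟨i, j⟩) b
        · exact hnone b
        · refine (hsome i j (F b)).trans ⟨?_, fun h => ⟨b, rfl, h⟩⟩
          rintro ⟨b', hb, h⟩
          rwa [hFinj hb] }
  have hvr : v ∈ (Set.range φ)ᶜ := fun ⟨a, ha⟩ => hFv a ha
  have hcross : ∀ x ∈ (Set.range φ)ᶜ, ∀ y, T.Adj x (φ y) ↔ x = v ∧ y = none := by
    intro x hx y
    rw [T.adj_comm]
    rcases y with _ | ⟨i, j⟩
    · refine (hu x).trans ⟨fun h => ⟨h.resolve_right ?_, rfl⟩, fun h => Or.inl h.1⟩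
      rintro ⟨i, rfl⟩
      exact hx ⟨some (i, 1), rfl⟩
    · refine (hsome i j x).trans ⟨?_, fun h => absurd h.2 (by simp)⟩
      rintro ⟨b, rfl, -⟩
      exact absurd ⟨b, rfl⟩ hx
  obtain ⟨z, hvz, hzu⟩ := hz
  have hzr : z ∈ (Set.range φ)ᶜ := by
    rintro ⟨a, rfl⟩
    obtain ⟨-, rfl⟩ := (hcross v hvr a).1 hvz
    exact hzu rfl
  refine familyF_of_join hT ht ih φ (v := v) (w := none) hvr hcross ⟨z, hzr, hvz.ne'⟩ ?_
  intro _ _ _ htK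
  exact ⟨isTight_of_join_treeR hr (v := ⟨v, hvr⟩) (z := ⟨z, hzr⟩) hvz htK, fun e => Or.inl ⟨r, hr, _, e⟩⟩

theorem exists_isLeafAt [Nontrivial V] (hT : T.IsTree) : ∃ r q, IsLeafAt T r q := by
  classical
  obtain ⟨r, hr⟩ := hT.exists_vert_degree_one_of_nontrivial
  obtain ⟨q, hq⟩ := Finset.card_eq_one.1 hr
  exact ⟨r, q, fun z => by rw [← mem_neighborFinset, hq, Finset.mem_singleton]⟩

/-- If neither two leaves share a support (`hA`) nor a pendant edge can be removed (`hB`), the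
branch three levels above a deepest vertex is forced to be some R_r. -/
theorem familyF_of_subtrees [Nontrivial V] (hT : T.IsTree) (ht : IsTight T)
    (ih : SubtreesInFamily T) : FamilyF T := by
  classical
  by_contra hF
  have hA : ∀ {v x y : V}, x ≠ y → IsLeafAt T x v → IsLeafAt T y v → False :=
    fun h1 h2 h3 => hF (familyF_of_two_leaves hT ht ih h1 h2 h3)
  have hB : ∀ {v₀ v₁ v₂ : V}, v₀ ≠ v₂ → IsLeafAt T v₀ v₁ →
      (∀ z, T.Adj v₁ z ↔ z = v₀ ∨ z = v₂) →
      ((∃ s, s ≠ v₁ ∧ ∀ z, T.Adj v₂ z ↔ z = v₁ ∨ z = s) ∨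
        ∃ s h, s ≠ v₁ ∧ T.Adj v₂ s ∧ h ≠ v₂ ∧ IsLeafAt T h s) → False :=
    fun h1 h2 h3 h4 => hF (familyF_of_pendant_edge hT ht ih h1 h2 h3 h4)
  -- The root is a leaf, so that `hA` excludes it where a parent is needed below.
  obtain ⟨r, q, hrq⟩ := exists_isLeafAt hT
  obtain ⟨v₀, -, hmax⟩ := Finset.univ.exists_max_image (T.dist r) ⟨r, Finset.mem_univ r⟩
  set d : V → ℕ := T.dist r with hd
  replace hmax : ∀ x, d x ≤ d v₀ := fun x => hmax x (Finset.mem_univ x)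
  have hadj : ∀ {x y : V}, T.Adj x y → d x = d y + 1 ∨ d y = d x + 1 := fun h => dist_adj hT r h
  have hdr : d r = 0 := dist_self
  have hne : ∀ {x y : V}, d x ≠ d y → x ≠ y := fun h h' => h (congrArg d h')
  have hchildless : ∀ {x p : V}, T.Adj x p → d x = d p + 1 →
      (∀ z, T.Adj x z → d z ≠ d x + 1) → IsLeafAt T x p := by
    intro x p hxp hdx hx z
    refine ⟨fun hz => ?_, fun h => h ▸ hxp⟩
    rcases hadj hz with h | h
    · exact parent_unique hT r hz hxp h hdx
    · exact absurd h (hx z hz)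
  have hdeep : ∀ {x p : V}, T.Adj x p → d x = d p + 1 → d x = d v₀ → IsLeafAt T x p := by
    intro x p hxp hdx hx
    refine hchildless hxp hdx fun z _ h => ?_
    have := hmax z
    omega
  have hdeg2 : ∀ {w c e : V}, T.Adj w c → d c = d w + 1 → T.Adj c e → d e = d c + 1 →
      d e = d v₀ → ∀ z, T.Adj c z ↔ z = e ∨ z = w := by
    intro w c e hwc hdc hce hde hm z
    constructor
    · intro hz
      rcases hadj hz with h | h
      · exact Or.inr (parent_unique hT r hz hwc.symm h hdc)
      · by_contra hcon
        rw [not_or] at hcon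
        exact hA hcon.1 (hdeep hz.symm h (by omega)) (hdeep hce.symm hde hm)
    · rintro (rfl | rfl)
      · exact hce
      · exact hwc.symm
  -- Apart from `c`, the children of `w` are leaves, since otherwise `w` would be adjacent to a
  -- support vertex and `hB` would apply. By `hA` there is at most one, and with none `w` would
  -- become a leaf once `c` and `e` are removed.
  have hP4 : ∀ {w c e : V}, T.Adj w c → d c = d w + 1 → T.Adj c e → d e = d c + 1 →
      d e = d v₀ → ∃ p l, d w = d p + 1 ∧ d l = d w + 1 ∧ IsLeafAt T l w ∧
        ∀ z, T.Adj w z ↔ z = p ∨ z = l ∨ z = c := by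
    intro w c e hwc hdc hce hde hm
    have hel : IsLeafAt T e c := hdeep hce.symm hde hm
    have hew : e ≠ w := hne (by omega)
    have hwr : w ≠ r := by
      rintro rfl
      obtain rfl := (hrq c).1 hwc
      exact hA hew hel hrq
    obtain ⟨p, hwp, hdp⟩ := exists_parent hT r hwr
    have hleaf : ∀ z, T.Adj w z → d z = d w + 1 → z ≠ c → IsLeafAt T z w := by
      intro z hz hdz hzc
      refine hchildless hz.symm hdz fun y hy hdy => ?_
      exact hB hew hel (hdeg2 hwc hdc hce hde hm) (Or.inr ⟨z, y, hzc, hz, hne (by omega),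
        hdeep hy.symm hdy (by omega)⟩)
    by_cases hl : ∃ l, T.Adj w l ∧ d l = d w + 1 ∧ l ≠ c
    · obtain ⟨l, hwl, hdl, hlc⟩ := hl
      refine ⟨p, l, hdp, hdl, hleaf l hwl hdl hlc, fun z => ⟨fun hz => ?_, ?_⟩⟩
      · rcases hadj hz with h | h
        · exact Or.inl (parent_unique hT r hz hwp h hdp)
        · by_contra hcon
          simp only [not_or] at hcon
          exact hA hcon.2.1 (hleaf z hz h hcon.2.2) (hleaf l hwl hdl hlc)
      · rintro (rfl | rfl | rfl) <;> assumption
    · refine (hB hew hel (hdeg2 hwc hdc hce hde hm) (Or.inl ⟨p, hne ?_, fun z =>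
        ⟨fun hz => ?_, ?_⟩⟩)).elim
      · change d w = d p + 1 at hdp
        omega
      · rcases hadj hz with h | h
        · exact Or.inr (parent_unique hT r hz hwp h hdp)
        · by_contra hcon
          rw [not_or] at hcon
          exact hl ⟨z, hz, h, hcon.1⟩
      · rintro (rfl | rfl) <;> assumption
  have hrq' : T.Adj r q := (hrq q).2 rfl
  have hv0r : v₀ ≠ r := by
    intro h
    have h1 := hmax q
    have h2 := hadj hrq'
    rw [h] at h1
    omega
  obtain ⟨v₁, h01, hd1⟩ := exists_parent hT r hv0r
  change d v₀ = d v₁ + 1 at hd1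
  -- Depth at most 1 below a root of degree one: the tree is P_2.
  by_cases hv1r : v₁ = r
  · apply hF
    subst hv1r
    have hall : ∀ x, x = v₁ ∨ x = v₀ := by
      intro x
      by_cases hx : x = v₁
      · exact Or.inl hx
      · obtain ⟨p, hxp, hdp⟩ := exists_parent hT v₁ hx
        have h1 := hmax x
        change d x = d p + 1 at hdp
        have h2 : p = v₁ := (hT.1.dist_eq_zero_iff.1 (show T.dist v₁ p = 0 by
          change d p = 0; omega)).symm
        subst h2
        exact Or.inr (((hrq x).1 hxp.symm).trans ((hrq v₀).1 h01.symm).symm)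
    let φ : pathGraph 2 ↪g T :=
      { toFun := ![v₁, v₀]
        inj' := by
          intro a b h
          fin_cases a <;> fin_cases b
          · rfl
          · exact absurd h h01.ne'
          · exact absurd h h01.ne
          · rfl
        map_rel_iff' := by
          intro a b
          rw [pathGraph_adj]
          fin_cases a <;> fin_cases b
          · exact ⟨fun h => absurd rfl h.ne, fun h => absurd h (by decide)⟩
          · exact ⟨fun _ => by decide, fun _ => h01.symm⟩
          · exact ⟨fun _ => by decide, fun _ => h01⟩
          · exact ⟨fun h => absurd rfl h.ne, fun h => absurd h (by decide)⟩ }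
    refine FamilyF.base T ⟨(RelIso.ofSurjective φ fun x => ?_ : pathGraph 2 ≃g T).symm⟩
    rcases hall x with rfl | rfl
    · exact ⟨0, rfl⟩
    · exact ⟨1, rfl⟩
  obtain ⟨v₂, h12, hd2⟩ := exists_parent hT r hv1r
  change d v₁ = d v₂ + 1 at hd2
  obtain ⟨u, l, hdu, hdl, hl, hN2⟩ := hP4 h12.symm hd2 h01.symm hd1 rfl
  have h2u : T.Adj v₂ u := (hN2 u).2 (Or.inl rfl)
  have hN1 := hdeg2 h12.symm hd2 h01.symm hd1 rfl
  have hN0 : IsLeafAt T v₀ v₁ := hdeep h01 hd1 rfl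
  have hv02 : v₀ ≠ v₂ := hne (by omega)
  have hul : ∀ h, IsLeafAt T h u → False := by
    intro h hh
    refine hB hv02 hN0 hN1 (Or.inr ⟨u, h, hne (by omega), h2u, ?_, hh⟩)
    rintro rfl
    exact hne (by omega) ((hh v₁).1 h12.symm)
  have hur : u ≠ r := by
    rintro rfl
    obtain rfl := (hrq v₂).1 h2u.symm
    exact hA (hne (by omega)) hrq hl
  obtain ⟨v, huv, hdv⟩ := exists_parent hT r hur
  change d u = d v + 1 at hdv
  have hchild : ∀ w : {w // T.Adj u w ∧ d w = d u + 1}, ∃ l c e : V,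
      (∀ z, T.Adj w.1 z ↔ z = u ∨ z = l ∨ z = c) ∧ IsLeafAt T l w.1 ∧
      (∀ z, T.Adj c z ↔ z = e ∨ z = w.1) ∧ IsLeafAt T e c ∧
      d l = d u + 2 ∧ d c = d u + 2 ∧ d e = d u + 3 := by
    rintro ⟨w, huw, hdw⟩
    by_cases hex : ∃ c e, T.Adj w c ∧ d c = d w + 1 ∧ T.Adj c e ∧ d e = d c + 1
    · obtain ⟨c, e, hwc, hdc, hce, hde⟩ := hex
      have hem : d e = d v₀ := by omega
      obtain ⟨p, l, hdp, hdl, hlw, hNw⟩ := hP4 hwc hdc hce hde hem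
      have hpu : p = u := parent_unique hT r ((hNw p).2 (Or.inl rfl)) huw.symm hdp hdw
      subst hpu
      exact ⟨l, c, e, hNw, hlw, hdeg2 hwc hdc hce hde hem, hdeep hce.symm hde hem,
        by omega, by omega, by omega⟩
    -- All children of `w` are leaves; there is exactly one, by `hul` and `hA`. So `w` and its child
    -- form a pendant edge at `u`, which is adjacent to the support vertex `v₂`, against `hB`.
    · exfalso
      have hwl : ∀ c, T.Adj w c → d c = d w + 1 → IsLeafAt T c w := fun c hc hdc =>
        hchildless hc.symm hdc fun e he hde => hex ⟨c, e, hc, hdc, he, hde⟩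
      obtain ⟨c, hwc, hdc⟩ : ∃ c, T.Adj w c ∧ d c = d w + 1 := by
        by_contra hcon
        exact hul w (hchildless huw.symm hdw fun z hz h => hcon ⟨z, hz, h⟩)
      refine hB (hne (by omega)) (hwl c hwc hdc) (v₂ := u) (fun z => ⟨fun hz => ?_, ?_⟩)
        (Or.inr ⟨v₂, l, ?_, h2u.symm, hne (by omega), hl⟩)
      · rcases hadj hz with h | h
        · exact Or.inr (parent_unique hT r hz huw.symm h hdw)
        · by_contra hcon
          rw [not_or] at hcon
          exact hA hcon.1 (hwl z hz h) (hwl c hwc hdc)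
      · rintro (rfl | rfl)
        · exact hwc
        · exact huw.symm
      · rintro rfl
        exact hex ⟨v₁, v₀, h12.symm, hd2, h01.symm, hd1⟩
  choose fl fc fe h1 h2 h3 h4 h5 h6 h7 using hchild
  let E := (Fintype.equivFin {w // T.Adj u w ∧ d w = d u + 1}).symm
  refine hF (familyF_of_treeR hT ht ih (d := d) (u := u) (v := v) (w := fun i => (E i).1)
    (l := fun i => fl (E i)) (c := fun i => fc (E i)) (e := fun i => fe (E i))
    (Fintype.card_pos_iff.2 ⟨⟨v₂, h2u.symm, hdu⟩⟩)
    (Subtype.val_injective.comp E.injective) (fun z => ⟨fun hz => ?_, ?_⟩)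
    (fun i => h1 (E i)) (fun i => h2 (E i)) (fun i => h3 (E i)) (fun i => h4 (E i)) hdv
    (fun i => (E i).2.2) (fun i => h5 (E i)) (fun i => h6 (E i)) (fun i => h7 (E i)) ?_)
  · rcases hadj hz with h | h
    · exact Or.inl (parent_unique hT r hz huv h hdv)
    · exact Or.inr ⟨E.symm ⟨z, hz, h⟩, by simp⟩
  · rintro (rfl | ⟨i, rfl⟩)
    · exact huv
    · exact (E i).2.1
  -- Without another neighbour, `v` would be a leaf attached to `u`, which `hul` forbids.
  · by_contra hcon
    refine hul v fun z => ⟨fun hz => ?_, ?_⟩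
    · by_contra hzu
      exact hcon ⟨z, hz, hzu⟩
    · rintro rfl
      exact huv.symm

theorem familyF_of_isTight (n : ℕ) : ∀ {V : Type u} [Fintype V] (T : SimpleGraph V),
    Fintype.card V = n → T.IsTree → Nontrivial V → IsTight T → FamilyF T := by
  classical
  induction n using Nat.strong_induction_on with
  | _ n ih =>
  intro V _ T hn hT _ ht
  refine familyF_of_subtrees hT ht fun s _ hs hTs hns hts => ?_
  refine ih (Fintype.card s) ?_ _ rfl hTs hns hts
  rw [← hn]
  obtain ⟨x, hx⟩ := (Set.ne_univ_iff_exists_notMem s).1 hs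
  exact Fintype.card_subtype_lt hx

end Steps

end TotalRoman

theorem mainTheorem11 {V : Type*} [Fintype V] (T : SimpleGraph V) (hT : T.IsTree)
    (hn : 2 ≤ Fintype.card V) :
    TotalRoman.gammaTR2 T = 2 * TotalRoman.gammaT T ↔
      TotalRoman.FamilyF T ∧ TotalRoman.FamilyT T := by
  classical
  have : Nontrivial V := Fintype.one_lt_card_iff_nontrivial.1 hn
  have hnbr : ∀ v, ∃ u, T.Adj v u := hT.1.preconnected.exists_adj_of_nontrivial
  have h1 := TotalRoman.gamma_le_gammaT hnbr
  have h2 := TotalRoman.gammaTR2_le_gamma_add_gammaT hnbr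
  have h3 := TotalRoman.two_mul_gamma_le_gammaTR2 hT hnbr
  constructor
  · intro h
    have hγ : TotalRoman.gammaT T = TotalRoman.gamma T := by omega
    refine ⟨TotalRoman.familyF_of_isTight _ T rfl hT this ?_, hT, hγ⟩
    -- Tightness is witnessed by label 2 on a minimum total dominating set, of weight 2γ_t = 2γ.
    obtain ⟨S, hS, hSc⟩ := TotalRoman.exists_gammaT hnbr
    refine ⟨_, hS.isTRDF, fun D hD => ?_⟩
    have := TotalRoman.gamma_le hD
    rw [TotalRoman.weight_indicator]
    omega
  · rintro ⟨-, -, h⟩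
    omega
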